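/- Let $k$ be a field of characteristic $0$ and let $$\mathcal P = k\langle s,t,t^{-1}\rangle/(tt^{-1}-1,\ t^{-1}t-1,\ s^2,\ st+ts)$$ be the algebra underlying Pareigis' Hopf algebra. Let $T=k[t,t^{-1}]$ be the Laurent polynomial ring and $T_{od}\subset T$ the $k$-span of the odd powers of $t$. For $n\ge 0$ let $HH_n(\mathcal P)$ be the $n$-th homology of the Hochschild complex $(\mathcal P^{\otimes (n+1)}, b)_{n\ge 0}$, where $\otimes=\otimes_k$ and $$b(x_0,\dots,x_n)=\sum_{i=0}^{n-1}(-1)^i(x_0,\dots,x_ix_{i+1},\dots,x_n)+(-1)^n(x_nx_0,x_1,\dots,x_{n-1}).$$ Then there are isomorphisms of $k$-vector spaces $$HH_n(\mathcal P)\cong\begin{cases}T & n=0,\\ T\oplus T_{od} & n=1,\\ T_{od}\oplus T_{od} & n>1,\end{cases}$$ and they can be chosen compatible with the gradings by degree in $t$: for every $r\in\mathbb Z$, the space of classes of those cycles that are linear combinations of tensors $s^{e_0}t^{m_0}\otimes\cdots\otimes s^{e_n}t^{m_n}$ with $m_0+\cdots+m_n=r$ is mapped onto the degree $r$ part of the right-hand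 side. -/

import Mathlib

open scoped TensorProduct LaurentPolynomial

section HochschildComplex

/-- For a tuple `(a₀, …, aₙ₊₁)` and `i ≤ n + 1`, the `i`-th face
`(a₀, …, aᵢ aᵢ₊₁, …, aₙ₊₁)` if `i ≤ n`, and `(aₙ₊₁ a₀, a₁, …, aₙ)` if `i = n + 1`. -/
def hochschildFaceTuple {A : Type*} [Mul A] {n : ℕ} (i : Fin (n + 2)) (a : Fin (n + 2) → A) :
    Fin (n + 1) → A :=
  fun j => if i = Fin.last (n + 1) ∧ j = 0 then a (Fin.last (n + 1)) * a 0
    else Fin.contractNth i (fun x y => x * y) a j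

theorem hochschildFaceTuple_natCast {A : Type*} [Mul A] {n : ℕ} (i : Fin (n + 2)) (g : ℕ → A) :
    hochschildFaceTuple i (fun x : Fin (n + 2) => g x) = fun x : Fin (n + 1) =>
      if (i : ℕ) = n + 1 ∧ (x : ℕ) = 0 then g (n + 1) * g 0
      else if (x : ℕ) < i then g x
      else if (x : ℕ) = i then g x * g (x + 1) else g (x + 1) := by
  funext x
  have h0 : x = 0 ↔ (x : ℕ) = 0 := by rw [Fin.ext_iff, Fin.val_zero]
  have h1 : i = Fin.last (n + 1) ↔ (i : ℕ) = n + 1 := by rw [Fin.ext_iff, Fin.val_last]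
  simp only [hochschildFaceTuple, Fin.contractNth, h0, h1, Fin.val_last, Fin.val_zero,
    Fin.val_castSucc, Fin.val_succ]

theorem hochschildFaceTuple_comm {A : Type*} [Semigroup A] {n : ℕ} (i : Fin (n + 2))
    (j : Fin (n + 3)) (h : (j : ℕ) ≤ i) (a : Fin (n + 3) → A) :
    hochschildFaceTuple i (hochschildFaceTuple j a) =
      hochschildFaceTuple (j.castLT (lt_of_le_of_lt h i.isLt)) (hochschildFaceTuple i.succ a) := by
  obtain ⟨g, rfl⟩ : ∃ g : ℕ → A, a = fun x : Fin (n + 3) => g x :=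
    ⟨fun m => if hm : m < n + 3 then a ⟨m, hm⟩ else a 0, by funext x; simp⟩
  have key : ∀ (l : Fin (n + 3)), hochschildFaceTuple l (fun x : Fin (n + 3) => g x) =
      fun x : Fin (n + 2) => (fun x : ℕ => if (l : ℕ) = n + 2 ∧ x = 0 then g (n + 2) * g 0
      else if x < l then g x
      else if x = l then g x * g (x + 1) else g (x + 1)) (x : ℕ) :=
    fun l => hochschildFaceTuple_natCast l g
  rw [key, key]
  rw [hochschildFaceTuple_natCast i (fun x : ℕ => if (j : ℕ) = n + 2 ∧ x = 0 then g (n + 2) * g 0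
      else if x < j then g x else if x = j then g x * g (x + 1) else g (x + 1)),
    hochschildFaceTuple_natCast _ (fun x : ℕ => if (i.succ : ℕ) = n + 2 ∧ x = 0 then
      g (n + 2) * g 0 else if x < i.succ then g x
      else if x = i.succ then g x * g (x + 1) else g (x + 1))]
  funext x
  have hi := i.isLt
  have hx := x.isLt
  simp only [Fin.val_succ, Fin.val_castLT]
  clear key
  have hass : ∀ u v w : A, u * v * w = u * (v * w) := mul_assoc
  grind

theorem hochschildFaceTuple_update {A : Type*} [Mul A] {n : ℕ} (i : Fin (n + 2))
    (a : Fin (n + 2) → A) (m : Fin (n + 2)) :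
    ∃ (j : Fin (n + 1)) (u : A → A),
      (u = id ∨ (∃ c, u = fun x => c * x) ∨ ∃ c, u = fun x => x * c) ∧
      ∀ x, hochschildFaceTuple i (Function.update a m x) =
        Function.update (hochschildFaceTuple i a) j (u x) := by
  by_cases hi : (i : ℕ) = n + 1
  · by_cases hm : (m : ℕ) = n + 1
    · refine ⟨0, fun x => x * a 0, Or.inr (Or.inr ⟨_, rfl⟩), fun x => ?_⟩
      funext k
      have := k.isLt
      simp only [hochschildFaceTuple, Fin.contractNth, Function.update_apply, Fin.ext_iff]
      grind
    · by_cases hm0 : (m : ℕ) = 0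
      · refine ⟨0, fun x => a (Fin.last _) * x, Or.inr (Or.inl ⟨_, rfl⟩), fun x => ?_⟩
        funext k
        have := k.isLt
        simp only [hochschildFaceTuple, Fin.contractNth, Function.update_apply, Fin.ext_iff]
        grind
      · refine ⟨⟨m, by omega⟩, id, Or.inl rfl, fun x => ?_⟩
        funext k
        have := k.isLt
        simp only [hochschildFaceTuple, Fin.contractNth, Function.update_apply, Fin.ext_iff]
        grind
  · by_cases hm : (m : ℕ) < i
    · refine ⟨⟨m, by omega⟩, id, Or.inl rfl, fun x => ?_⟩
      funext k
      have := k.isLt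
      simp only [hochschildFaceTuple, Fin.contractNth, Function.update_apply, Fin.ext_iff]
      grind
    · by_cases hm1 : (m : ℕ) = i
      · refine ⟨⟨m, by omega⟩, fun x => x * a ⟨m + 1, by omega⟩,
          Or.inr (Or.inr ⟨_, rfl⟩), fun x => ?_⟩
        funext k
        have := k.isLt
        simp only [hochschildFaceTuple, Fin.contractNth, Function.update_apply, Fin.ext_iff]
        grind
      · by_cases hm2 : (m : ℕ) = i + 1
        · refine ⟨⟨i, by omega⟩, fun x => a i * x, Or.inr (Or.inl ⟨_, rfl⟩), fun x => ?_⟩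
          funext k
          have := k.isLt
          simp only [hochschildFaceTuple, Fin.contractNth, Function.update_apply, Fin.ext_iff]
          grind
        · refine ⟨⟨m - 1, by omega⟩, id, Or.inl rfl, fun x => ?_⟩
          funext k
          have := k.isLt
          simp only [hochschildFaceTuple, Fin.contractNth, Function.update_apply, Fin.ext_iff]
          grind

variable (k : Type*) [CommRing k] (A : Type*) [Ring A] [Algebra k A]

/-- Hochschild `n`-chains `A ⊗ A ⊗ ⋯ ⊗ A` (`n + 1` factors, over `k`). -/
abbrev HochschildChain (n : ℕ) : Type _ := ⨂[k] _ : Fin (n + 1), A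

/-- The face map `dᵢ : A^{⊗(n+2)} → A^{⊗(n+1)}`. -/
noncomputable def hochschildFace {n : ℕ} (i : Fin (n + 2)) :
    HochschildChain k A (n + 1) →ₗ[k] HochschildChain k A n :=
  PiTensorProduct.lift
    (MultilinearMap.mk' (fun a => PiTensorProduct.tprod k (hochschildFaceTuple i a))
      (by
        intro a m x y
        obtain ⟨j, u, hu, h⟩ := hochschildFaceTuple_update i a m
        have hu' : u (x + y) = u x + u y := by
          rcases hu with rfl | ⟨c, rfl⟩ | ⟨c, rfl⟩ <;> simp [mul_add, add_mul]
        simp only [h, hu', MultilinearMap.map_update_add])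
      (by
        intro a m c x
        obtain ⟨j, u, hu, h⟩ := hochschildFaceTuple_update i a m
        have hu' : u (c • x) = c • u x := by
          rcases hu with rfl | ⟨c, rfl⟩ | ⟨c, rfl⟩ <;> simp
        simp only [h, hu', MultilinearMap.map_update_smul]))

@[simp]
theorem hochschildFace_tprod {n : ℕ} (i : Fin (n + 2)) (a : Fin (n + 2) → A) :
    hochschildFace k A i (PiTensorProduct.tprod k a) =
      PiTensorProduct.tprod k (hochschildFaceTuple i a) := by
  simp [hochschildFace]

/-- The Hochschild boundary `b = ∑ᵢ (-1)ⁱ dᵢ : A^{⊗(n+2)} → A^{⊗(n+1)}`. -/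
noncomputable def hochschildBoundary (n : ℕ) :
    HochschildChain k A (n + 1) →ₗ[k] HochschildChain k A n :=
  ∑ i : Fin (n + 2), (-1 : k) ^ (i : ℕ) • hochschildFace k A i

theorem hochschildFace_comp {n : ℕ} (i : Fin (n + 2)) (j : Fin (n + 3)) (h : (j : ℕ) ≤ i) :
    hochschildFace k A i ∘ₗ hochschildFace k A j =
      hochschildFace k A (j.castLT (lt_of_le_of_lt h i.isLt)) ∘ₗ hochschildFace k A i.succ := by
  ext a
  simp [hochschildFaceTuple_comm i j h]

/-- The Hochschild boundary squares to zero. -/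
theorem hochschildBoundary_comp (n : ℕ) :
    hochschildBoundary k A n ∘ₗ hochschildBoundary k A (n + 1) = 0 := by
  have hsum : hochschildBoundary k A n ∘ₗ hochschildBoundary k A (n + 1) =
      ∑ i : Fin (n + 2), ∑ j : Fin (n + 3), ((-1 : k) ^ (i : ℕ) * (-1 : k) ^ (j : ℕ)) •
        (hochschildFace k A i ∘ₗ hochschildFace k A j) := by
    refine LinearMap.ext fun x => ?_
    simp only [hochschildBoundary, LinearMap.comp_apply, LinearMap.sum_apply,
      LinearMap.smul_apply, map_sum, map_smul, Finset.smul_sum, smul_smul]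
    rw [Finset.sum_comm]
    simp only [mul_comm]
  rw [hsum, ← Finset.sum_product']
  let P := Fin (n + 2) × Fin (n + 3)
  let S : Finset P := {ij : P | (ij.2 : ℕ) ≤ (ij.1 : ℕ)}
  rw [Finset.univ_product_univ, ← Finset.sum_add_sum_compl S, ← eq_neg_iff_add_eq_zero,
    ← Finset.sum_neg_distrib]
  let φ : ∀ ij : P, ij ∈ S → P := fun ij hij =>
    (Fin.castLT ij.2 (lt_of_le_of_lt (Finset.mem_filter.mp hij).right (Fin.is_lt ij.1)),
      ij.1.succ)
  apply Finset.sum_bij φ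
  · intro ij hij
    simp_rw [S, φ, Finset.compl_filter, Finset.mem_filter_univ, Fin.val_succ,
      Fin.val_castLT] at hij ⊢
    lia
  · rintro ⟨i, j⟩ hij ⟨i', j'⟩ hij' h
    have h1 : (j : ℕ) = j' := congrArg (fun p : P => (p.1 : ℕ)) h
    have h2 : (i : ℕ) + 1 = i' + 1 := congrArg (fun p : P => (p.2 : ℕ)) h
    exact Prod.ext (Fin.ext (by simpa using h2)) (Fin.ext h1)
  · rintro ⟨i', j'⟩ hij'
    simp_rw [S, Finset.compl_filter, Finset.mem_filter_univ, not_le] at hij'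
    refine ⟨(⟨j' - 1, by omega⟩, Fin.castSucc i'), ?_, ?_⟩
    · simp only [S, Finset.mem_filter_univ, Fin.val_castSucc]
      omega
    · refine Prod.ext (Fin.ext rfl) (Fin.ext ?_)
      simp only [φ, Fin.val_succ]
      omega
  · rintro ⟨i, j⟩ hij
    have hij' : (j : ℕ) ≤ i := by simpa [S] using hij
    simp only [φ, hochschildFace_comp k A i j hij', Fin.val_succ, Fin.val_castLT]
    refine Eq.trans ?_ (neg_smul _ _)
    congr 1
    ring

/-- Hochschild `n`-cycles: everything for `n = 0`, the kernel of the boundary for `n > 0`. -/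
noncomputable def hochschildCycles : (n : ℕ) → Submodule k (HochschildChain k A n)
  | 0 => ⊤
  | n + 1 => LinearMap.ker (hochschildBoundary k A n)

/-- Hochschild `n`-boundaries. -/
noncomputable def hochschildBoundaries (n : ℕ) : Submodule k (HochschildChain k A n) :=
  LinearMap.range (hochschildBoundary k A n)

/-- The Hochschild homology `HHₙ(A)` of the `k`-algebra `A`: cycles modulo boundaries. -/
abbrev HochschildHomology (n : ℕ) : Type _ :=
  hochschildCycles k A n ⧸ (hochschildBoundaries k A n).submoduleOf (hochschildCycles k A n)

end HochschildComplex

section Pareigis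

/-- The free generators `s`, `t`, `t⁻¹`. -/
inductive PareigisGen : Type
  | s
  | t
  | tInv

variable (k : Type*) [CommRing k]

/-- The relations `t t⁻¹ = 1`, `t⁻¹ t = 1`, `s² = 0`, `s t + t s = 0`. -/
inductive PareigisRel : FreeAlgebra k PareigisGen → FreeAlgebra k PareigisGen → Prop
  | t_mul_tInv : PareigisRel (FreeAlgebra.ι k .t * FreeAlgebra.ι k .tInv) 1
  | tInv_mul_t : PareigisRel (FreeAlgebra.ι k .tInv * FreeAlgebra.ι k .t) 1
  | s_sq : PareigisRel (FreeAlgebra.ι k .s * FreeAlgebra.ι k .s) 0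
  | anticomm : PareigisRel
      (FreeAlgebra.ι k .s * FreeAlgebra.ι k .t + FreeAlgebra.ι k .t * FreeAlgebra.ι k .s) 0

/-- The underlying `k`-algebra of Pareigis' Hopf algebra,
`k⟨s, t, t⁻¹⟩ / (t t⁻¹ - 1, t⁻¹ t - 1, s², s t + t s)`. -/
abbrev PareigisAlgebra : Type _ := RingQuot (PareigisRel k)

/-- The element `s` of Pareigis' algebra. -/
noncomputable def PareigisAlgebra.s : PareigisAlgebra k :=
  RingQuot.mkAlgHom k (PareigisRel k) (FreeAlgebra.ι k .s)

/-- The invertible element `t` of Pareigis' algebra. -/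
noncomputable def PareigisAlgebra.t : (PareigisAlgebra k)ˣ where
  val := RingQuot.mkAlgHom k (PareigisRel k) (FreeAlgebra.ι k .t)
  inv := RingQuot.mkAlgHom k (PareigisRel k) (FreeAlgebra.ι k .tInv)
  val_inv := by
    rw [← map_mul, RingQuot.mkAlgHom_rel k PareigisRel.t_mul_tInv, map_one]
  inv_val := by
    rw [← map_mul, RingQuot.mkAlgHom_rel k PareigisRel.tInv_mul_t, map_one]

/-- The Hochschild `n`-chains of Pareigis' algebra of total degree `r` in `t`: the span of the
`s^{e₀} t^{m₀} ⊗ ⋯ ⊗ s^{eₙ} t^{mₙ}` with `m₀ + ⋯ + mₙ = r`. -/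
noncomputable def pareigisChainsOfDegree (n : ℕ) (r : ℤ) :
    Submodule k (HochschildChain k (PareigisAlgebra k) n) :=
  Submodule.span k {x | ∃ (e : Fin (n + 1) → ℕ) (m : Fin (n + 1) → ℤ), ∑ i, m i = r ∧
    x = PiTensorProduct.tprod k (fun i => PareigisAlgebra.s k ^ e i *
      ((PareigisAlgebra.t k ^ m i : (PareigisAlgebra k)ˣ) : PareigisAlgebra k))}

/-- The part of `HHₙ` of Pareigis' algebra of degree `r` in `t`: the classes of cycles of total
degree `r` in `t`. -/
noncomputable def pareigisHomologyOfDegree (n : ℕ) (r : ℤ) :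
    Submodule k (HochschildHomology k (PareigisAlgebra k) n) :=
  ((pareigisChainsOfDegree k n r).submoduleOf (hochschildCycles k (PareigisAlgebra k) n)).map
    (Submodule.mkQ _)

/-- The line `k tʳ` in `k[t, t⁻¹]`. -/
noncomputable def laurentDegree (r : ℤ) : Submodule k k[T;T⁻¹] :=
  Submodule.span k {LaurentPolynomial.T r}

/-- `T_od`, the span in `k[t, t⁻¹]` of the odd powers of `t`. -/
noncomputable def laurentOdd : Submodule k k[T;T⁻¹] :=
  Submodule.span k {x | ∃ r : ℤ, Odd r ∧ x = LaurentPolynomial.T r}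

/-- The degree `r` part of `T_od`. -/
noncomputable def laurentOddDegree (r : ℤ) : Submodule k (laurentOdd k) :=
  (laurentDegree k r).submoduleOf (laurentOdd k)

end Pareigis

/-! ### Comparison maps and homotopies for free complexes with a contraction -/

section FreeComplexes

/-! Write A for the algebra; it has the basis tᵐ, s tᵐ. It is a twisted product of k[s]/(s²), whose
bimodule resolution is periodic with maps s ⊗ 1 ∓ 1 ⊗ s, and of k[t, t⁻¹], whose bimodule resolution
has two terms joined by t ⊗ 1 − 1 ⊗ t. Combining the two, with signs dictated by ts = −st, gives a
small complex of free bimodules on generators xₙ in degree n and yₙ in degree n + 1, with d xₙ₊₁ =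
(s ⊗ 1 − (−1)ⁿ 1 ⊗ s) xₙ and d yₙ = (t ⊗ 1 − (−1)ⁿ 1 ⊗ t) xₙ + (s ⊗ 1 − (−1)ⁿ 1 ⊗ s) yₙ₋₁, the last
term being absent for n = 0. It has an explicit right-linear contraction built from the twisted
difference quotients of tᵐ (`resD_contraction`).

The bar complex has the contraction p[w]q ↦ 1[p|w]q. Between free complexes with contractions, an
isomorphism in degree 0 extends recursively to chain maps both ways, and the composites are
homotopic to the identity (`comparison_comm`, `nullHomotopy_spec`). Coinvariants turn the bar
complex into the Hochschild complex (`consEquiv_coinvMap_barD`) and the small resolution into a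
small complex with the same homology (`exists_hochschildHomology_equiv`).

In the small complex every differential carries a basis vector to a combination of basis vectors
with coefficients 0 or ±2. As 2 is invertible, the homology can be read off: tᵐ x₀ in degree 0; tᵐ
y₀ for all m and s tᵐ x₁ for m odd in degree 1; above that, one family on xₙ and one on yₙ₋₁, each
with one class for every odd total degree. This is certified by maps onto and from the answer and a
homotopy (`smallHomotopyZero_spec`, `smallHomotopy_zero_spec`, `smallHomotopy_succ_spec`).

For the grading, xₙ has degree 0 and yₙ has degree 1. Differentials and contractions are
homogeneous, hence so are the comparison maps built from them; the isomorphism on homology and its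
inverse therefore both preserve degree. -/

/-- The `E`-linear map out of the free module `E ⊗ V` extending a `k`-linear map out of `V`. -/
noncomputable def freeLift {k E V N : Type*} [CommRing k] [Ring E] [Algebra k E]
    [AddCommGroup V] [Module k V] [AddCommGroup N] [Module k N] [Module E N] [IsScalarTower k E N]
    (γ : V →ₗ[k] N) : E ⊗[k] V →ₗ[E] N :=
  TensorProduct.AlgebraTensorModule.lift (LinearMap.toSpanSingleton E (V →ₗ[k] N) γ)

@[simp]
theorem freeLift_tmul {k E V N : Type*} [CommRing k] [Ring E] [Algebra k E]
    [AddCommGroup V] [Module k V] [AddCommGroup N] [Module k N] [Module E N] [IsScalarTower k E N]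
    (γ : V →ₗ[k] N) (e : E) (v : V) : freeLift γ (e ⊗ₜ v) = e • γ v := rfl

theorem tmul_eq_smul_one_tmul {k E V : Type*} [CommRing k] [Ring E] [Algebra k E]
    [AddCommGroup V] [Module k V] (e : E) (v : V) :
    (e ⊗ₜ[k] v : E ⊗[k] V) = e • ((1 : E) ⊗ₜ[k] v) := by
  rw [TensorProduct.smul_tmul', smul_eq_mul, mul_one]

theorem smul_free_tmul {k E V : Type*} [CommRing k] [Ring E] [Algebra k E]
    [AddCommGroup V] [Module k V] (e e' : E) (v : V) :
    e • (e' ⊗ₜ[k] v : E ⊗[k] V) = (e * e') ⊗ₜ[k] v := rfl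

theorem free_hom_ext {k E V N : Type*} [CommRing k] [Ring E] [Algebra k E]
    [AddCommGroup V] [Module k V] [AddCommGroup N] [Module E N]
    {φ ψ : E ⊗[k] V →ₗ[E] N} (h : ∀ v : V, φ ((1 : E) ⊗ₜ v) = ψ ((1 : E) ⊗ₜ v)) : φ = ψ := by
  refine LinearMap.ext fun x => ?_
  induction x with
  | zero => simp
  | add x y hx hy => simp [hx, hy]
  | tmul e v => rw [tmul_eq_smul_one_tmul, map_smul, map_smul, h]

variable {k E : Type*} [CommRing k] [Ring E] [Algebra k E]
  {V W : ℕ → Type*} [∀ n, AddCommGroup (V n)] [∀ n, Module k (V n)]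
  [∀ n, AddCommGroup (W n)] [∀ n, Module k (W n)]

/-- The inclusion of the generators `V` in the free module `E ⊗ V`. -/
noncomputable abbrev freeIncl (k E : Type*) [CommRing k] [Ring E] [Algebra k E] (V : Type*)
    [AddCommGroup V] [Module k V] : V →ₗ[k] E ⊗[k] V :=
  TensorProduct.mk k E V 1

/-- The comparison map from a complex of free modules to a contractible complex. -/
noncomputable def comparison (φ : E ⊗[k] V 0 →ₗ[E] E ⊗[k] W 0)
    (d : ∀ n, E ⊗[k] V (n + 1) →ₗ[E] E ⊗[k] V n)
    (σ : ∀ n, E ⊗[k] W n →ₗ[k] E ⊗[k] W (n + 1)) : ∀ n, E ⊗[k] V n →ₗ[E] E ⊗[k] W n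
  | 0 => φ
  | n + 1 => freeLift (σ n ∘ₗ (comparison φ d σ n).restrictScalars k ∘ₗ
      (d n).restrictScalars k ∘ₗ freeIncl k E (V (n + 1)))

theorem comparison_succ_tmul (φ : E ⊗[k] V 0 →ₗ[E] E ⊗[k] W 0)
    (d : ∀ n, E ⊗[k] V (n + 1) →ₗ[E] E ⊗[k] V n)
    (σ : ∀ n, E ⊗[k] W n →ₗ[k] E ⊗[k] W (n + 1)) (n : ℕ) (e : E) (v : V (n + 1)) :
    comparison φ d σ (n + 1) (e ⊗ₜ v) =
      e • σ n (comparison φ d σ n (d n ((1 : E) ⊗ₜ v))) := rfl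

/-- On a generator v the comparison map is σ applied to the image of dv. That image is a cycle by
induction, so the contraction identity says that σ lifts it through d'. In degree 0, d'σ is not the
identity, only the identity on boundaries; `h0` supplies what is needed there. -/
theorem comparison_comm (φ : E ⊗[k] V 0 →ₗ[E] E ⊗[k] W 0)
    (d : ∀ n, E ⊗[k] V (n + 1) →ₗ[E] E ⊗[k] V n)
    (d' : ∀ n, E ⊗[k] W (n + 1) →ₗ[E] E ⊗[k] W n)
    (σ : ∀ n, E ⊗[k] W n →ₗ[k] E ⊗[k] W (n + 1))
    (hdd : ∀ n x, d n (d (n + 1) x) = 0)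
    (hσ : ∀ n x, d' (n + 1) (σ (n + 1) x) + σ n (d' n x) = x)
    (h0 : ∀ v : V 1, d' 0 (σ 0 (φ (d 0 ((1 : E) ⊗ₜ v)))) = φ (d 0 ((1 : E) ⊗ₜ v))) (n : ℕ)
    (x : E ⊗[k] V (n + 1)) :
    d' n (comparison φ d σ (n + 1) x) = comparison φ d σ n (d n x) := by
  induction n with
  | zero =>
    refine LinearMap.congr_fun (f := d' 0 ∘ₗ comparison φ d σ 1)
      (g := comparison φ d σ 0 ∘ₗ d 0) (free_hom_ext fun v => ?_) x
    simp only [LinearMap.comp_apply, comparison_succ_tmul, one_smul]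
    exact h0 v
  | succ n ih =>
    refine LinearMap.congr_fun (f := d' (n + 1) ∘ₗ comparison φ d σ (n + 2))
      (g := comparison φ d σ (n + 1) ∘ₗ d (n + 1)) (free_hom_ext fun v => ?_) x
    simp only [LinearMap.comp_apply, comparison_succ_tmul φ d σ (n + 1), one_smul]
    have := hσ n (comparison φ d σ (n + 1) (d (n + 1) ((1 : E) ⊗ₜ v)))
    rwa [ih, hdd, map_zero, map_zero, add_zero] at this

/-- The null-homotopy of an endomorphism `ψ`, zero in degree `0`, of a contractible complex of
free modules. -/
noncomputable def nullHomotopy (d : ∀ n, E ⊗[k] V (n + 1) →ₗ[E] E ⊗[k] V n)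
    (σ : ∀ n, E ⊗[k] V n →ₗ[k] E ⊗[k] V (n + 1))
    (ψ : ∀ n, E ⊗[k] V n →ₗ[E] E ⊗[k] V n) : ∀ n, E ⊗[k] V n →ₗ[E] E ⊗[k] V (n + 1)
  | 0 => 0
  | n + 1 => freeLift (σ (n + 1) ∘ₗ
      (ψ (n + 1) - nullHomotopy d σ ψ n ∘ₗ d n).restrictScalars k ∘ₗ freeIncl k E (V (n + 1)))

/-- The error ψ − h d is a cycle on generators by the previous stage, so applying σ to it gives the
next stage of the homotopy. Since ψ vanishes in degree 0, the recursion can start with 0. -/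
theorem nullHomotopy_spec (d : ∀ n, E ⊗[k] V (n + 1) →ₗ[E] E ⊗[k] V n)
    (σ : ∀ n, E ⊗[k] V n →ₗ[k] E ⊗[k] V (n + 1))
    (ψ : ∀ n, E ⊗[k] V n →ₗ[E] E ⊗[k] V n)
    (hdd : ∀ n x, d n (d (n + 1) x) = 0)
    (hσ : ∀ n x, d (n + 1) (σ (n + 1) x) + σ n (d n x) = x)
    (hψ0 : ψ 0 = 0) (hψ : ∀ n x, d n (ψ (n + 1) x) = ψ n (d n x)) (n : ℕ)
    (x : E ⊗[k] V (n + 1)) :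
    d (n + 1) (nullHomotopy d σ ψ (n + 1) x) + nullHomotopy d σ ψ n (d n x) = ψ (n + 1) x := by
  induction n with
  | zero =>
    refine LinearMap.congr_fun (f := d 1 ∘ₗ nullHomotopy d σ ψ 1 + nullHomotopy d σ ψ 0 ∘ₗ d 0)
      (g := ψ 1) (free_hom_ext fun v => ?_) x
    have := hσ 0 (ψ 1 ((1 : E) ⊗ₜ v))
    rw [hψ, hψ0, LinearMap.zero_apply, map_zero, add_zero] at this
    simpa [nullHomotopy] using this
  | succ n ih =>
    refine LinearMap.congr_fun (f := d (n + 2) ∘ₗ nullHomotopy d σ ψ (n + 2) +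
      nullHomotopy d σ ψ (n + 1) ∘ₗ d (n + 1)) (g := ψ (n + 2)) (free_hom_ext fun v => ?_) x
    have h1 := hσ (n + 1) (ψ (n + 2) ((1 : E) ⊗ₜ v) -
      nullHomotopy d σ ψ (n + 1) (d (n + 1) ((1 : E) ⊗ₜ v)))
    have h2 := ih (d (n + 1) ((1 : E) ⊗ₜ v))
    rw [hdd, map_zero, add_zero] at h2
    rw [map_sub (d (n + 1)), h2, hψ, sub_self, map_zero, add_zero] at h1
    rw [LinearMap.add_apply, LinearMap.comp_apply, LinearMap.comp_apply]
    rw [show nullHomotopy d σ ψ (n + 2) ((1 : E) ⊗ₜ v) = σ (n + 2) (ψ (n + 2) ((1 : E) ⊗ₜ v) -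
      nullHomotopy d σ ψ (n + 1) (d (n + 1) ((1 : E) ⊗ₜ v))) from one_smul E _, h1]
    abel

end FreeComplexes

/-! ### The enveloping algebra and coinvariants of free bimodules -/

section Coinvariants

open MulOpposite

/-- The enveloping algebra `A ⊗ Aᵐᵒᵖ`. -/
def EnvelopingAlgebra (k A : Type*) [CommRing k] [Ring A] [Algebra k A] : Type _ :=
  A ⊗[k] Aᵐᵒᵖ

namespace EnvelopingAlgebra

variable (k A : Type*) [CommRing k] [Ring A] [Algebra k A]

noncomputable instance : Ring (EnvelopingAlgebra k A) := inferInstanceAs (Ring (A ⊗[k] Aᵐᵒᵖ))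

noncomputable instance : Algebra k (EnvelopingAlgebra k A) :=
  inferInstanceAs (Algebra k (A ⊗[k] Aᵐᵒᵖ))

/-- The bilinear map `(p, q) ↦ p ⊗ q`. -/
noncomputable def biTmul : A →ₗ[k] A →ₗ[k] EnvelopingAlgebra k A :=
  (TensorProduct.mk k A Aᵐᵒᵖ).compl₂ (opLinearEquiv k).toLinearMap

variable {A}

theorem biTmul_mul_biTmul (p q p' q' : A) :
    biTmul k A p q * biTmul k A p' q' = biTmul k A (p * p') (q' * q) :=
  Algebra.TensorProduct.tmul_mul_tmul p p' (op q) (op q')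

theorem biTmul_one_one : biTmul k A 1 1 = 1 := rfl

variable {k}

theorem induction_on {motive : EnvelopingAlgebra k A → Prop} (e : EnvelopingAlgebra k A)
    (zero : motive 0) (mk : ∀ p q, motive (biTmul k A p q))
    (add : ∀ x y, motive x → motive y → motive (x + y)) : motive e :=
  TensorProduct.induction_on e zero (fun p q => mk p (unop q)) add

theorem hom_ext {N : Type*} [AddCommGroup N] [Module k N]
    {φ ψ : EnvelopingAlgebra k A →ₗ[k] N} (h : ∀ p q, φ (biTmul k A p q) = ψ (biTmul k A p q)) :
    φ = ψ :=
  TensorProduct.ext' fun p q => h p (unop q)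

/-- The linear map out of the enveloping algebra defined by a bilinear map. -/
noncomputable def lift {N : Type*} [AddCommGroup N] [Module k N] (β : A →ₗ[k] A →ₗ[k] N) :
    EnvelopingAlgebra k A →ₗ[k] N :=
  TensorProduct.lift (β.compl₂ (opLinearEquiv k).symm.toLinearMap)

@[simp]
theorem lift_mk {N : Type*} [AddCommGroup N] [Module k N] (β : A →ₗ[k] A →ₗ[k] N) (p q : A) :
    lift β (biTmul k A p q) = β p q := rfl

end EnvelopingAlgebra

open EnvelopingAlgebra

variable (k A : Type*) [CommRing k] [Ring A] [Algebra k A]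
  (V W U : Type*) [AddCommGroup V] [Module k V] [AddCommGroup W] [Module k W]
  [AddCommGroup U] [Module k U]

variable {k A V} in
theorem free_induction_on {motive : EnvelopingAlgebra k A ⊗[k] V → Prop}
    (x : EnvelopingAlgebra k A ⊗[k] V) (zero : motive 0)
    (tmul : ∀ p q v, motive (biTmul k A p q ⊗ₜ v))
    (add : ∀ x y, motive x → motive y → motive (x + y)) : motive x := by
  induction x with
  | zero => exact zero
  | add x y hx hy => exact add x y hx hy
  | tmul e v =>
    induction e using EnvelopingAlgebra.induction_on with
    | zero => rwa [TensorProduct.zero_tmul]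
    | mk p q => exact tmul p q v
    | add x y hx hy => rw [TensorProduct.add_tmul]; exact add _ _ hx hy

/-- The quotient map `p ⊗ q ↦ q p` of the enveloping algebra onto `A`. -/
noncomputable def envelopeMul : EnvelopingAlgebra k A →ₗ[k] A :=
  lift (LinearMap.mul k A).flip

@[simp]
theorem envelopeMul_mk (p q : A) : envelopeMul k A (biTmul k A p q) = q * p := rfl

/-- The quotient map of the free bimodule `A ⊗ V ⊗ A` onto its coinvariants `A ⊗ V`. -/
noncomputable def coinvMk : EnvelopingAlgebra k A ⊗[k] V →ₗ[k] A ⊗[k] V :=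
  TensorProduct.map (envelopeMul k A) LinearMap.id

@[simp]
theorem coinvMk_tmul (e : EnvelopingAlgebra k A) (v : V) :
    coinvMk k A V (e ⊗ₜ v) = envelopeMul k A e ⊗ₜ v := rfl

/-- The section `a ⊗ v ↦ 1 ⊗ v ⊗ a` of `coinvMk`. -/
noncomputable def coinvSection : A ⊗[k] V →ₗ[k] EnvelopingAlgebra k A ⊗[k] V :=
  TensorProduct.map (biTmul k A 1) LinearMap.id

@[simp]
theorem coinvSection_tmul (a : A) (v : V) :
    coinvSection k A V (a ⊗ₜ v) = biTmul k A 1 a ⊗ₜ v := rfl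

theorem coinvMk_section (x : A ⊗[k] V) : coinvMk k A V (coinvSection k A V x) = x := by
  induction x with
  | zero => simp
  | add x y hx hy => simp [hx, hy]
  | tmul a v => simp

/-- Passing to coinvariants identifies left with right multiplication, so a left factor p can be
carried around cyclically to the right end. -/
theorem coinvMk_smul (p q : A) (x : EnvelopingAlgebra k A ⊗[k] V) :
    coinvMk k A V (biTmul k A p q • x) = coinvMk k A V (biTmul k A 1 (q * p) • x) := by
  induction x using free_induction_on with
  | zero => simp
  | add x y hx hy => simp only [smul_add, map_add, hx, hy]
  | tmul a b v => simp [TensorProduct.smul_tmul', biTmul_mul_biTmul, mul_assoc]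

variable {k A V W U}

/-- The map induced on coinvariants by a map of free bimodules. -/
noncomputable def coinvMap (Φ : EnvelopingAlgebra k A ⊗[k] V →ₗ[EnvelopingAlgebra k A]
    EnvelopingAlgebra k A ⊗[k] W) : A ⊗[k] V →ₗ[k] A ⊗[k] W :=
  coinvMk k A W ∘ₗ Φ.restrictScalars k ∘ₗ coinvSection k A V

theorem coinvMap_tmul (Φ : EnvelopingAlgebra k A ⊗[k] V →ₗ[EnvelopingAlgebra k A]
    EnvelopingAlgebra k A ⊗[k] W) (a : A) (v : V) : coinvMap Φ (a ⊗ₜ v) =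
      coinvMk k A W (biTmul k A 1 a • Φ (1 ⊗ₜ v)) := by
  rw [← Φ.map_smul, ← tmul_eq_smul_one_tmul]
  rfl

/-- Although `coinvMap` is defined through a section that is not bimodule-linear, it is the map that
Φ induces on the quotient. Functoriality follows from this. -/
theorem coinvMap_mk (Φ : EnvelopingAlgebra k A ⊗[k] V →ₗ[EnvelopingAlgebra k A]
    EnvelopingAlgebra k A ⊗[k] W) (x : EnvelopingAlgebra k A ⊗[k] V) :
    coinvMap Φ (coinvMk k A V x) = coinvMk k A W (Φ x) := by
  induction x using free_induction_on with
  | zero => simp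
  | add x y hx hy => simp only [map_add, hx, hy]
  | tmul p q v =>
    rw [coinvMk_tmul, coinvMap_tmul, tmul_eq_smul_one_tmul (biTmul k A p q), Φ.map_smul,
      coinvMk_smul k A W p q,
      envelopeMul_mk]

theorem coinvMap_comp (Ψ : EnvelopingAlgebra k A ⊗[k] W →ₗ[EnvelopingAlgebra k A]
    EnvelopingAlgebra k A ⊗[k] U) (Φ : EnvelopingAlgebra k A ⊗[k] V →ₗ[EnvelopingAlgebra k A]
    EnvelopingAlgebra k A ⊗[k] W) (x : A ⊗[k] V) :
    coinvMap Ψ (coinvMap Φ x) = coinvMap (Ψ ∘ₗ Φ) x := by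
  conv_lhs => rw [← coinvMk_section k A V x, coinvMap_mk, coinvMap_mk]
  rfl

theorem coinvMap_id (x : A ⊗[k] V) :
    coinvMap (LinearMap.id : EnvelopingAlgebra k A ⊗[k] V →ₗ[EnvelopingAlgebra k A] _) x = x :=
  coinvMk_section k A V x

theorem coinvMap_add (Φ Ψ : EnvelopingAlgebra k A ⊗[k] V →ₗ[EnvelopingAlgebra k A]
    EnvelopingAlgebra k A ⊗[k] W) (x : A ⊗[k] V) :
    coinvMap (Φ + Ψ) x = coinvMap Φ x + coinvMap Ψ x := by
  simp [coinvMap]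

end Coinvariants

/-! ### The bar complex and its coinvariants -/

section BarComplex

open EnvelopingAlgebra

variable (k A : Type*) [CommRing k] [Ring A] [Algebra k A]

/-- The `n`-fold tensor power `A ⊗ ⋯ ⊗ A`. -/
abbrev TensorWords (n : ℕ) : Type _ := ⨂[k] _ : Fin n, A

/-- Prepending a tensor factor, `A ⊗ A^{⊗n} ≃ A^{⊗(n+1)}`. -/
noncomputable def consEquiv (n : ℕ) : A ⊗[k] TensorWords k A n ≃ₗ[k] TensorWords k A (n + 1) :=
  LinearEquiv.ofLinearMap
    (TensorProduct.lift (PiTensorProduct.lift.toLinearMap ∘ₗ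
      (PiTensorProduct.tprod k (s := fun _ : Fin (n + 1) => A)).curryLeft))
    (PiTensorProduct.lift (LinearMap.uncurryLeft (M := fun _ : Fin (n + 1) => A)
      (PiTensorProduct.lift.symm.toLinearMap ∘ₗ TensorProduct.mk k A (TensorWords k A n))))
    (by
      ext v
      simp [PiTensorProduct.lift_symm])
    (by
      ext a v
      simp [PiTensorProduct.lift_symm])

@[simp]
theorem consEquiv_tmul_tprod (n : ℕ) (a : A) (w : Fin n → A) :
    consEquiv k A n (a ⊗ₜ PiTensorProduct.tprod k w) =
      PiTensorProduct.tprod k (Fin.cons a w : Fin (n + 1) → A) := by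
  simp [consEquiv]

@[simp]
theorem consEquiv_symm_tprod (n : ℕ) (v : Fin (n + 1) → A) :
    (consEquiv k A n).symm (PiTensorProduct.tprod k v) =
      v 0 ⊗ₜ PiTensorProduct.tprod k (Fin.tail v) := by
  rw [LinearEquiv.symm_apply_eq, consEquiv_tmul_tprod, Fin.cons_self_tail]

/-- The contraction `p [w] q ↦ 1 [p | w] q` of the bar complex. -/
noncomputable def barContraction (n : ℕ) : EnvelopingAlgebra k A ⊗[k] TensorWords k A n →ₗ[k]
    EnvelopingAlgebra k A ⊗[k] TensorWords k A (n + 1) :=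
  TensorProduct.lift (EnvelopingAlgebra.lift (LinearMap.mk₂ k
    (fun p q => TensorProduct.mk k (EnvelopingAlgebra k A) (TensorWords k A (n + 1)) (biTmul k A 1
      q) ∘ₗ
      (consEquiv k A n).toLinearMap ∘ₗ TensorProduct.mk k A (TensorWords k A n) p)
    (fun p p' q => by
      refine LinearMap.ext fun w => ?_
      simp [TensorProduct.tmul_add])
    (fun c p q => by
      refine LinearMap.ext fun w => ?_
      simp)
    (fun p q q' => by
      refine LinearMap.ext fun w => ?_
      simp)
    (fun c p q => by
      refine LinearMap.ext fun w => ?_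
      simp [TensorProduct.smul_tmul'])))

@[simp]
theorem barContraction_tmul (n : ℕ) (p q : A) (w : TensorWords k A n) :
    barContraction k A n (biTmul k A p q ⊗ₜ w) = biTmul k A 1 q ⊗ₜ consEquiv k A n (p ⊗ₜ w) := rfl

/-- The contraction respects only the right action. This suffices to reduce identities about it to
elements of the form a[w]1. -/
theorem barContraction_smul (n : ℕ) (q : A) (x : EnvelopingAlgebra k A ⊗[k] TensorWords k A n) :
    barContraction k A n (biTmul k A 1 q • x) = biTmul k A 1 q • barContraction k A n x := by
  induction x using free_induction_on with
  | zero => simp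
  | add x y hx hy => simp only [smul_add, map_add, hx, hy]
  | tmul a b v => simp [TensorProduct.smul_tmul', biTmul_mul_biTmul]

/-- The map `a ⊗ v ↦ a [v] 1`. -/
noncomputable def leftCoeff (V : Type*) [AddCommGroup V] [Module k V] :
    A ⊗[k] V →ₗ[k] EnvelopingAlgebra k A ⊗[k] V :=
  TensorProduct.map ((biTmul k A).flip 1) LinearMap.id

@[simp]
theorem leftCoeff_tmul (V : Type*) [AddCommGroup V] [Module k V] (a : A) (v : V) :
    leftCoeff k A V (a ⊗ₜ v) = biTmul k A a 1 ⊗ₜ v := rfl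

/-- The differential of the bar complex, determined by its contraction. -/
noncomputable def barD : ∀ n : ℕ, EnvelopingAlgebra k A ⊗[k] TensorWords k A (n + 1)
    →ₗ[EnvelopingAlgebra k A] EnvelopingAlgebra k A ⊗[k] TensorWords k A n
  | 0 => freeLift ((leftCoeff k A _ - coinvSection k A _) ∘ₗ (consEquiv k A 0).symm.toLinearMap)
  | n + 1 => freeLift ((leftCoeff k A _ - barContraction k A n ∘ₗ
      (barD n).restrictScalars k ∘ₗ leftCoeff k A _) ∘ₗ (consEquiv k A (n + 1)).symm.toLinearMap)

theorem barD_zero_cons (e : EnvelopingAlgebra k A) (a : A) (w : TensorWords k A 0) :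
    barD k A 0 (e ⊗ₜ consEquiv k A 0 (a ⊗ₜ w)) =
      e • (biTmul k A a 1 ⊗ₜ w - biTmul k A 1 a ⊗ₜ w) := by
  simp [barD]

theorem barD_succ_cons (n : ℕ) (e : EnvelopingAlgebra k A) (a : A) (w : TensorWords k A (n + 1)) :
    barD k A (n + 1) (e ⊗ₜ consEquiv k A (n + 1) (a ⊗ₜ w)) =
      e • (biTmul k A a 1 ⊗ₜ w - barContraction k A n (barD k A n (biTmul k A a 1 ⊗ₜ w))) := by
  simp [barD]

/-- On a[w]1 this is the recursive definition of `barD`, solved for a[w]1; right linearity gives the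
rest. -/
theorem barD_contraction (n : ℕ) (x : EnvelopingAlgebra k A ⊗[k] TensorWords k A (n + 1)) :
    barD k A (n + 1) (barContraction k A (n + 1) x) + barContraction k A n (barD k A n x) = x := by
  induction x using free_induction_on with
  | zero => simp
  | add x y hx hy =>
    simp only [map_add]
    conv_rhs => rw [← hx, ← hy]
    abel
  | tmul p q w =>
    have h : (biTmul k A p q ⊗ₜ[k] w : EnvelopingAlgebra k A ⊗[k] TensorWords k A (n + 1)) =
        biTmul k A 1 q • (biTmul k A p 1 ⊗ₜ[k] w) := by
      rw [TensorProduct.smul_tmul', smul_eq_mul, biTmul_mul_biTmul, one_mul, one_mul]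
    rw [barContraction_tmul, barD_succ_cons, smul_sub, ← barContraction_smul,
      ← (barD k A n).map_smul, ← h, sub_add_cancel]

/-- In degree 0 the contraction identity has the augmentation p ⊗ q ↦ pq as its error term. That
term vanishes on boundaries. -/
theorem barD_contraction_zero (p q : A) (w : TensorWords k A 0) :
    barD k A 0 (barContraction k A 0 (biTmul k A p q ⊗ₜ w)) =
      biTmul k A p q ⊗ₜ w - biTmul k A 1 (p * q) ⊗ₜ w := by
  rw [barContraction_tmul, barD_zero_cons, smul_sub, TensorProduct.smul_tmul',
    TensorProduct.smul_tmul', smul_eq_mul, smul_eq_mul, biTmul_mul_biTmul, biTmul_mul_biTmul]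
  simp

theorem tensorWords_induction {n : ℕ} {motive : TensorWords k A (n + 1) → Prop}
    (v : TensorWords k A (n + 1)) (cons : ∀ a w, motive (consEquiv k A n (a ⊗ₜ w)))
    (add : ∀ x y, motive x → motive y → motive (x + y)) : motive v := by
  obtain ⟨x, rfl⟩ := (consEquiv k A n).surjective v
  induction x with
  | zero => simpa using cons 0 0
  | add x y hx hy => rw [map_add]; exact add _ _ hx hy
  | tmul a w => exact cons a w

/-- By definition d(1[a|w]1) = z − σdz with z = a[w]1, so its boundary is dz − dσ(dz). The
contraction identity and induction give dσ(dz) = dz. In the lowest degree the two augmentation terms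
are both ab and cancel. -/
theorem barD_barD (n : ℕ) (x : EnvelopingAlgebra k A ⊗[k] TensorWords k A (n + 2)) :
    barD k A n (barD k A (n + 1) x) = 0 := by
  induction n with
  | zero =>
    refine LinearMap.congr_fun (f := barD k A 0 ∘ₗ barD k A 1) (g := 0)
      (free_hom_ext fun v => ?_) x
    induction v using tensorWords_induction with
    | add x y hx hy => simp only [TensorProduct.tmul_add, map_add, hx, hy]
    | cons a w =>
      induction w using tensorWords_induction with
      | add x y hx hy => simp only [TensorProduct.tmul_add, map_add, hx, hy]
      | cons b w =>
        rw [LinearMap.comp_apply, barD_succ_cons, one_smul, map_sub, barD_zero_cons, smul_sub,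
          TensorProduct.smul_tmul', TensorProduct.smul_tmul', smul_eq_mul, smul_eq_mul,
          biTmul_mul_biTmul,
          biTmul_mul_biTmul, map_sub, map_sub, barD_contraction_zero, barD_contraction_zero]
        simp
  | succ n ih =>
    refine LinearMap.congr_fun (f := barD k A (n + 1) ∘ₗ barD k A (n + 2)) (g := 0)
      (free_hom_ext fun v => ?_) x
    induction v using tensorWords_induction with
    | add x y hx hy => simp only [TensorProduct.tmul_add, map_add, hx, hy]
    | cons a w =>
      have := barD_contraction k A n (barD k A (n + 1) (biTmul k A a 1 ⊗ₜ w))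
      rw [ih, map_zero, add_zero] at this
      rw [LinearMap.comp_apply, barD_succ_cons, one_smul, map_sub, this, sub_self,
        LinearMap.zero_apply]

theorem contractNth_zero_cons {n : ℕ} (a : A) (w : Fin (n + 1) → A) :
    Fin.contractNth 0 (fun x y => x * y) (Fin.cons a w : Fin (n + 2) → A) =
      (Fin.cons (a * w 0) (Fin.tail w) : Fin (n + 1) → A) := by
  funext j
  refine Fin.cases ?_ (fun j => ?_) j
  · simp [Fin.contractNth]
  · simp [Fin.contractNth, Fin.tail]

theorem contractNth_succ_cons {n : ℕ} (i : Fin (n + 1)) (a : A) (w : Fin (n + 1) → A) :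
    Fin.contractNth i.succ (fun x y => x * y) (Fin.cons a w : Fin (n + 2) → A) =
      (Fin.cons a (Fin.contractNth i (fun x y => x * y) w) : Fin (n + 1) → A) := by
  funext j
  refine Fin.cases ?_ (fun j => ?_) j
  · simp [Fin.contractNth]
  · simp only [Fin.contractNth, Fin.cons_succ, Fin.val_succ, Nat.add_lt_add_iff_right,
      Nat.add_right_cancel_iff]
    rfl

/-- The usual formula for the differential of the bar complex. -/
theorem barD_tprod (n : ℕ) (v : Fin (n + 1) → A) :
    barD k A n (1 ⊗ₜ PiTensorProduct.tprod k v) =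
      biTmul k A (v 0) 1 ⊗ₜ PiTensorProduct.tprod k (Fin.tail v) +
      ∑ i : Fin n, (-1 : k) ^ (i + 1 : ℕ) • ((1 : EnvelopingAlgebra k A) ⊗ₜ[k]
        PiTensorProduct.tprod k (Fin.contractNth i.castSucc (fun x y => x * y) v)) +
      (-1 : k) ^ (n + 1) • (biTmul k A 1 (v (Fin.last n)) ⊗ₜ[k]
        PiTensorProduct.tprod k (Fin.init v)) := by
  induction n with
  | zero =>
    rw [← Fin.cons_self_tail v, ← consEquiv_tmul_tprod, barD_zero_cons]
    simp [sub_eq_add_neg]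
    rw [Subsingleton.elim (Fin.init v) (Fin.tail v)]
    exact ((neg_smul (1 : k) _).trans (congrArg _ (one_smul k _))).symm
  | succ n ih =>
    obtain ⟨a, w, rfl⟩ : ∃ (a : A) (w : Fin (n + 1) → A), v = Fin.cons a w :=
      ⟨v 0, Fin.tail v, (Fin.cons_self_tail v).symm⟩
    have h1 : Fin.init (Fin.cons a w : Fin (n + 2) → A) =
        (Fin.cons a (Fin.init w) : Fin (n + 1) → A) := by
      funext j
      refine Fin.cases ?_ (fun j => ?_) j
      · simp [Fin.init]
      · simp only [Fin.init, Fin.cons_succ]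
        rw [← Fin.succ_castSucc, Fin.cons_succ]
    have h2 (c : k) (x : EnvelopingAlgebra k A ⊗[k] TensorWords k A (n + 1)) :
        (-c) • x = -(c • x) := neg_smul c x
    -- Applying σ to a · d(1[w]1) puts a at the front of every word. The outer left term becomes the
    -- face that multiplies a into the first letter, every other term keeps a as first letter, and
    -- the minus sign shifts all the signs by one.
    rw [← consEquiv_tmul_tprod, barD_succ_cons, one_smul, tmul_eq_smul_one_tmul (biTmul k A a 1),
      (barD k A n).map_smul, ih, Fin.sum_univ_succ, h1]
    simp only [Fin.cons_zero, Fin.tail_cons, Fin.castSucc_zero, contractNth_zero_cons,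
      Fin.castSucc_succ, contractNth_succ_cons, smul_add, Finset.smul_sum, map_add, map_sum,
      smul_free_tmul, smul_comm (biTmul k A a 1) (_ : k), biTmul_mul_biTmul, mul_one,
      barContraction_tmul,
      ← biTmul_one_one, consEquiv_tmul_tprod, map_smul, Fin.cons_last, Fin.val_succ,
      Fin.val_zero, zero_add, pow_one, pow_succ _ (_ + 1), h2, mul_neg, one_smul,
      Finset.sum_neg_distrib]
    abel

/-- The coinvariants of the bar complex form the Hochschild complex. -/
theorem consEquiv_coinvMap_barD (n : ℕ) (x : A ⊗[k] TensorWords k A (n + 1)) :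
    consEquiv k A n (coinvMap (barD k A n) x) =
      hochschildBoundary k A n (consEquiv k A (n + 1) x) := by
  refine LinearMap.congr_fun (f := (consEquiv k A n).toLinearMap ∘ₗ coinvMap (barD k A n))
    (g := hochschildBoundary k A n ∘ₗ (consEquiv k A (n + 1)).toLinearMap)
    (TensorProduct.ext (LinearMap.ext fun a => PiTensorProduct.ext
      (MultilinearMap.ext fun v => ?_))) x
  have h0 : hochschildFaceTuple 0 (Fin.cons a v : Fin (n + 2) → A) =
      (Fin.cons (a * v 0) (Fin.tail v) : Fin (n + 1) → A) := by
    rw [← contractNth_zero_cons]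
    funext j
    have h : ¬ ((0 : Fin (n + 2)) = Fin.last (n + 1) ∧ j = 0) := fun h => by
      simpa using congrArg Fin.val h.1
    rw [hochschildFaceTuple, if_neg h]
  have h1 : ∀ i : Fin n, hochschildFaceTuple i.castSucc.succ (Fin.cons a v : Fin (n + 2) → A) =
      (Fin.cons a (Fin.contractNth i.castSucc (fun x y => x * y) v) : Fin (n + 1) → A) := by
    intro i
    rw [← contractNth_succ_cons]
    funext j
    have := i.isLt
    simp only [hochschildFaceTuple, Fin.ext_iff, Fin.val_succ, Fin.val_castSucc, Fin.val_last]
    rw [if_neg (by omega)]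
  have h2 : hochschildFaceTuple (Fin.last n).succ (Fin.cons a v : Fin (n + 2) → A) =
      (Fin.cons (v (Fin.last n) * a) (Fin.init v) : Fin (n + 1) → A) := by
    funext j
    refine Fin.cases ?_ (fun j => ?_) j
    · simp [hochschildFaceTuple, Fin.cons_last]
    · have := j.isLt
      simp only [hochschildFaceTuple, Fin.ext_iff, Fin.contractNth, Fin.val_succ, Fin.val_last,
        Fin.cons_succ, Fin.init]
      rw [if_neg (by simp), if_pos (by omega), ← Fin.succ_castSucc, Fin.cons_succ]
  change consEquiv k A n (coinvMap (barD k A n) (a ⊗ₜ PiTensorProduct.tprod k v)) =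
    hochschildBoundary k A n (consEquiv k A (n + 1) (a ⊗ₜ PiTensorProduct.tprod k v))
  simp only [consEquiv_tmul_tprod, hochschildBoundary, LinearMap.sum_apply,
    LinearMap.smul_apply, hochschildFace_tprod]
  -- The first and last faces are the two terms of the bar differential with coefficients outside
  -- the word; these coefficients multiply a on the right and on the left. The middle faces do not
  -- touch a.
  rw [Fin.sum_univ_succ, Fin.sum_univ_castSucc, h0, h2, coinvMap_tmul, barD_tprod]
  simp only [h1, smul_add, Finset.smul_sum, map_add, map_sum, smul_free_tmul,
    smul_comm (biTmul k A 1 a) (_ : k), biTmul_mul_biTmul, mul_one, one_mul, ← biTmul_one_one,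
      map_smul,
    coinvMk_tmul, envelopeMul_mk, consEquiv_tmul_tprod, Fin.val_zero, pow_zero, one_smul,
    Fin.val_succ, Fin.val_castSucc, Fin.val_last, add_assoc]

end BarComplex

/-! ### Signs -/

/-- The sign `(-1)ᵐ` as an element of `k`. -/
def intSign (k : Type*) [Ring k] (m : ℤ) : k := ((m.negOnePow : ℤ) : k)

section IntSign

variable (k : Type*) [Ring k]

@[simp] theorem intSign_zero : intSign k 0 = 1 := by simp [intSign]

@[simp] theorem intSign_one : intSign k 1 = -1 := by simp [intSign]

theorem intSign_add (m n : ℤ) : intSign k (m + n) = intSign k m * intSign k n := by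
  simp [intSign, Int.negOnePow_add]

theorem intSign_add_one (m : ℤ) : intSign k (m + 1) = -intSign k m := by
  simp [intSign_add]

theorem intSign_sub_one (m : ℤ) : intSign k (m - 1) = -intSign k m := by
  have := intSign_add_one k (m - 1)
  rw [sub_add_cancel] at this
  rw [this, neg_neg]

theorem intSign_even {m : ℤ} (h : Even m) : intSign k m = 1 := by
  simp [intSign, Int.negOnePow_even m h]

theorem intSign_odd {m : ℤ} (h : ¬ Even m) : intSign k m = -1 := by
  simp [intSign, Int.negOnePow_odd m (Int.not_even_iff_odd.mp h)]

end IntSign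

/-! ### Normal form: the basis tᵐ, s tᵐ -/

/-- Generators `s`, `t` of an algebra over `k` satisfying the relations of Pareigis' algebra. -/
structure PareigisElements (k A : Type*) [CommRing k] [Ring A] [Algebra k A] where
  /-- the nilpotent generator -/
  s : A
  /-- the invertible generator -/
  t : Aˣ
  s_mul_s : s * s = 0
  t_mul_s : t * s = -(s * t)

namespace PareigisElements

variable {k A : Type*} [CommRing k] [Ring A] [Algebra k A] (P : PareigisElements k A)

/-- The power `tᵐ`. -/
def tPow (m : ℤ) : A := ((P.t ^ m : Aˣ) : A)

@[simp] theorem tPow_zero : P.tPow 0 = 1 := by simp [tPow]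

theorem tPow_one : P.tPow 1 = P.t := by simp [tPow]

theorem tPow_neg_one : P.tPow (-1) = (P.t⁻¹ : Aˣ) := by simp [tPow]

theorem tPow_add (m n : ℤ) : P.tPow (m + n) = P.tPow m * P.tPow n := by
  simp [tPow, zpow_add]

theorem tPow_mul_s (m : ℤ) : P.tPow m * P.s = intSign k m • (P.s * P.tPow m) := by
  have h1 : P.tPow 1 * P.s = -(P.s * P.tPow 1) := by rw [tPow_one, t_mul_s]
  induction m with
  | zero => simp
  | succ m ih =>
    rw [tPow_add, mul_assoc, h1, mul_neg, ← mul_assoc, ih, intSign_add_one,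
      smul_mul_assoc, neg_smul, mul_assoc]
  | pred m ih =>
    have h : P.tPow (-m) = P.tPow 1 * P.tPow (-m - 1) := by
      rw [← tPow_add]
      congr 1
      ring
    have h' : P.tPow (-1) * P.tPow 1 = 1 := by rw [← tPow_add]; simp
    -- The descending step comes from multiplying by t⁻¹ on the left, after splitting off one factor
    -- t and moving it across s.
    have h2 := congrArg (P.tPow (-1) * ·) ih
    simp only [mul_smul_comm] at h2
    rw [h, mul_assoc, ← mul_assoc, h', one_mul, ← mul_assoc P.s, ← neg_neg (P.s * P.tPow 1),
      ← h1, neg_mul, mul_neg, ← mul_assoc, ← mul_assoc, h', one_mul] at h2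
    rw [h2, intSign_sub_one, neg_smul, smul_neg]

theorem s_mul_tPow_mul_s (m : ℤ) : P.s * P.tPow m * P.s = 0 := by
  rw [mul_assoc, tPow_mul_s, mul_smul_comm, ← mul_assoc, s_mul_s, zero_mul, smul_zero]

/-- The elements `tᵐ` and `s tᵐ`. -/
def monomial : ℤ ⊕ ℤ → A :=
  Sum.elim P.tPow (fun m => P.s * P.tPow m)

/-- A subspace containing `tᵐ` and `s tᵐ` for all `m` and generated by them is stable under left
multiplication by `s` and by powers of `t`. -/
theorem mul_mem_span_monomial (a : A) (h : a = P.s ∨ ∃ n, a = P.tPow n) (y : A)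
    (hy : y ∈ Submodule.span k (Set.range P.monomial)) :
    a * y ∈ Submodule.span k (Set.range P.monomial) := by
  have ht (m : ℤ) : P.tPow m ∈ Submodule.span k (Set.range P.monomial) :=
    Submodule.subset_span ⟨Sum.inl m, rfl⟩
  have hs (m : ℤ) : P.s * P.tPow m ∈ Submodule.span k (Set.range P.monomial) :=
    Submodule.subset_span ⟨Sum.inr m, rfl⟩
  have hle : Submodule.span k (Set.range P.monomial) ≤
      (Submodule.span k (Set.range P.monomial)).comap (LinearMap.mulLeft k a) := by
    rw [Submodule.span_le]
    rintro _ ⟨m | m, rfl⟩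
    · rcases h with rfl | ⟨n, rfl⟩
      · exact hs m
      · change P.tPow n * P.tPow m ∈ Submodule.span k (Set.range P.monomial)
        rw [← tPow_add]
        exact ht _
    · rcases h with rfl | ⟨n, rfl⟩
      · change P.s * (P.s * P.tPow m) ∈ Submodule.span k (Set.range P.monomial)
        rw [← mul_assoc, s_mul_s, zero_mul]
        exact Submodule.zero_mem _
      · change P.tPow n * (P.s * P.tPow m) ∈ Submodule.span k (Set.range P.monomial)
        rw [← mul_assoc, tPow_mul_s, smul_mul_assoc, mul_assoc, ← tPow_add]
        exact Submodule.smul_mem _ _ (hs _)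
  exact hle hy

end PareigisElements

namespace PareigisAlgebra

variable (k : Type*) [CommRing k]

/-- The generators of Pareigis' algebra. -/
noncomputable def elements : PareigisElements k (PareigisAlgebra k) where
  s := s k
  t := t k
  s_mul_s := by
    rw [s, ← map_mul, RingQuot.mkAlgHom_rel k PareigisRel.s_sq, map_zero]
  t_mul_s := by
    refine eq_neg_of_add_eq_zero_right ?_
    change RingQuot.mkAlgHom k (PareigisRel k) _ * RingQuot.mkAlgHom k (PareigisRel k) _ +
      RingQuot.mkAlgHom k (PareigisRel k) _ * RingQuot.mkAlgHom k (PareigisRel k) _ = 0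
    rw [← map_mul, ← map_mul, ← map_add, RingQuot.mkAlgHom_rel k PareigisRel.anticomm, map_zero]

/-- The span contains 1 and is stable under left multiplication by the generators, hence is a left
ideal containing 1. -/
theorem span_monomial : ⊤ ≤ Submodule.span k (Set.range (elements k).monomial) := by
  have key (x : FreeAlgebra k PareigisGen) :
      ∀ y ∈ Submodule.span k (Set.range (elements k).monomial),
        RingQuot.mkAlgHom k (PareigisRel k) x * y ∈
          Submodule.span k (Set.range (elements k).monomial) := by
    induction x using FreeAlgebra.induction with
    | grade0 r =>
      intro y hy
      rw [AlgHom.commutes, ← Algebra.smul_def]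
      exact Submodule.smul_mem _ _ hy
    | grade1 g =>
      refine (elements k).mul_mem_span_monomial _ ?_
      cases g with
      | s => exact Or.inl rfl
      | t => exact Or.inr ⟨1, ((elements k).tPow_one).symm⟩
      | tInv => exact Or.inr ⟨-1, ((elements k).tPow_neg_one).symm⟩
    | mul a b ha hb => intro y hy; rw [map_mul, mul_assoc]; exact ha _ (hb _ hy)
    | add a b ha hb =>
      intro y hy; rw [map_add, add_mul]; exact Submodule.add_mem _ (ha _ hy) (hb _ hy)
  intro x _
  obtain ⟨x, rfl⟩ := RingQuot.mkAlgHom_surjective k (PareigisRel k) x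
  rw [← mul_one (RingQuot.mkAlgHom k (PareigisRel k) x)]
  exact key x 1 (Submodule.subset_span ⟨Sum.inl 0, (elements k).tPow_zero⟩)

open LaurentPolynomial in
/-- A faithful representation of Pareigis' algebra by upper triangular matrices. -/
noncomputable def rep : PareigisAlgebra k →ₐ[k] Matrix (Fin 2) (Fin 2) k[T;T⁻¹] :=
  RingQuot.liftAlgHom k ⟨FreeAlgebra.lift k fun g => match g with
    | .s => !![0, 1; 0, 0]
    | .t => !![-T 1, 0; 0, T 1]
    | .tInv => !![-T (-1), 0; 0, T (-1)], by
    have h0 : (0 : Matrix (Fin 2) (Fin 2) k[T;T⁻¹]) = !![0, 0; 0, 0] := by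
      ext i j : 2
      fin_cases i <;> fin_cases j <;> rfl
    intro x y h
    cases h <;> simp only [map_mul, map_add, FreeAlgebra.lift_ι_apply, map_one, map_zero,
      Matrix.mul_fin_two, Matrix.one_fin_two, h0, Matrix.of_add_of, Matrix.cons_add_cons,
      Matrix.empty_add_empty] <;>
      simp only [mul_zero, zero_mul, add_zero, zero_add, mul_neg, neg_mul, one_mul,
        mul_one, ← T_add, T_zero, neg_zero, neg_neg, add_neg_cancel, neg_add_cancel]⟩

theorem rep_s : rep k (elements k).s = !![0, 1; 0, 0] := by
  change rep k (RingQuot.mkAlgHom k (PareigisRel k) _) = _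
  rw [rep, RingQuot.liftAlgHom_mkAlgHom_apply, FreeAlgebra.lift_ι_apply]

open LaurentPolynomial in
theorem rep_tPow (m : ℤ) : rep k ((elements k).tPow m) = !![intSign k m • T m, 0; 0, T m] := by
  have h1 : rep k ((elements k).tPow 1) = !![-T 1, 0; 0, T 1] := by
    rw [PareigisElements.tPow_one]
    change rep k (RingQuot.mkAlgHom k (PareigisRel k) _) = _
    rw [rep, RingQuot.liftAlgHom_mkAlgHom_apply, FreeAlgebra.lift_ι_apply]
  have h2 : rep k ((elements k).tPow (-1)) = !![-T (-1), 0; 0, T (-1)] := by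
    rw [PareigisElements.tPow_neg_one]
    change rep k (RingQuot.mkAlgHom k (PareigisRel k) _) = _
    rw [rep, RingQuot.liftAlgHom_mkAlgHom_apply, FreeAlgebra.lift_ι_apply]
  induction m with
  | zero =>
    rw [PareigisElements.tPow_zero, map_one, intSign_zero, one_smul, T_zero, Matrix.one_fin_two]
  | succ m ih =>
    rw [PareigisElements.tPow_add, map_mul, ih, h1, intSign_add_one, Matrix.mul_fin_two]
    simp only [mul_zero, zero_mul, add_zero, zero_add, mul_neg, neg_smul, smul_mul_assoc, ← T_add,
      neg_zero]
  | pred m ih =>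
    rw [sub_eq_add_neg, PareigisElements.tPow_add, map_mul, ih, h2, ← sub_eq_add_neg,
      intSign_sub_one, Matrix.mul_fin_two]
    simp only [mul_zero, zero_mul, add_zero, zero_add, mul_neg, neg_smul, smul_mul_assoc, ← T_add,
      sub_eq_add_neg, neg_zero]

/-- The coordinate `∑ aₘ tᵐ + ∑ bₘ s tᵐ ↦ ∑ aₘ Tᵐ`. -/
noncomputable def evenCoord : PareigisAlgebra k →ₗ[k] k[T;T⁻¹] :=
  Matrix.entryLinearMap k k[T;T⁻¹] 1 1 ∘ₗ (rep k).toLinearMap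

/-- The coordinate `∑ aₘ tᵐ + ∑ bₘ s tᵐ ↦ ∑ bₘ Tᵐ`. -/
noncomputable def oddCoord : PareigisAlgebra k →ₗ[k] k[T;T⁻¹] :=
  Matrix.entryLinearMap k k[T;T⁻¹] 0 1 ∘ₗ (rep k).toLinearMap

theorem evenCoord_monomial : evenCoord k ∘ (elements k).monomial =
    Sum.elim LaurentPolynomial.T (fun _ => 0) := by
  funext m
  cases m <;> simp [evenCoord, PareigisElements.monomial, rep_tPow, rep_s]

theorem oddCoord_monomial : oddCoord k ∘ (elements k).monomial =
    Sum.elim (fun _ => 0) LaurentPolynomial.T := by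
  funext m
  cases m <;> simp [oddCoord, PareigisElements.monomial, rep_tPow, rep_s]

/-- In the representation `rep` the element tᵐ is diagonal and s tᵐ is Tᵐ in the upper right corner.
The lower right and upper right entries therefore separate the two families, and coefficients of
Laurent polynomials separate the powers. -/
theorem linearIndependent_monomial : LinearIndependent k (elements k).monomial := by
  rw [linearIndependent_iff]
  intro l hl
  have e0 := congrArg (evenCoord k) hl
  have e1 := congrArg (oddCoord k) hl
  rw [Finsupp.apply_linearCombination, Finsupp.linearCombination_apply, map_zero] at e0 e1
  rw [evenCoord_monomial] at e0
  rw [oddCoord_monomial] at e1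
  have hc (m : ℤ) : ∃ c : k[T;T⁻¹] →ₗ[k] k, ∀ n, c (LaurentPolynomial.T n) =
      if n = m then 1 else 0 :=
    ⟨⟨⟨fun p => p.coeff m, fun p q => by simp⟩, fun a p => by simp⟩,
      fun n => LaurentPolynomial.T_apply m n⟩
  refine Finsupp.ext fun x => ?_
  rcases x with m | m <;> obtain ⟨c, hc⟩ := hc m
  · have h := congrArg c e0
    rw [map_zero, Finsupp.sum, map_sum, Finset.sum_eq_single (Sum.inl m)] at h
    · simpa [hc] using h
    · rintro (n | n) _ hn
      · simp only [ne_eq, Sum.inl.injEq] at hn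
        simp [hc, hn]
      · simp
    · intro h
      simp [Finsupp.notMem_support_iff.mp h]
  · have h := congrArg c e1
    rw [map_zero, Finsupp.sum, map_sum, Finset.sum_eq_single (Sum.inr m)] at h
    · simpa [hc] using h
    · rintro (n | n) _ hn
      · simp
      · simp only [ne_eq, Sum.inr.injEq] at hn
        simp [hc, hn]
    · intro h
      simp [Finsupp.notMem_support_iff.mp h]

end PareigisAlgebra

theorem intSign_congr (k : Type*) [Ring k] {a b : ℤ} (h : Even (a - b)) :
    intSign k a = intSign k b := by
  rw [← sub_add_cancel a b, intSign_add, intSign_even k h, one_mul]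

/-! ### Twisted difference quotients of powers of t -/

section IntervalSum

variable {M : Type*} [AddCommGroup M]

/-- The sum `g 0 + ⋯ + g (m - 1)`, extended to negative `m` so that
`intervalSum_add_one` holds. -/
noncomputable def intervalSum (g : ℤ → M) (m : ℤ) : M :=
  ∑ i ∈ Finset.Ico 0 m, g i - ∑ i ∈ Finset.Ico m 0, g i

@[simp] theorem intervalSum_zero (g : ℤ → M) : intervalSum g 0 = 0 := by simp [intervalSum]

theorem intervalSum_add_one (g : ℤ → M) (m : ℤ) :
    intervalSum g (m + 1) = intervalSum g m + g m := by
  by_cases h : 0 ≤ m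
  · have h1 : Finset.Ico 0 (m + 1) = insert m (Finset.Ico 0 m) := by
      ext i; simp only [Finset.mem_Ico, Finset.mem_insert]; omega
    have h2 : Finset.Ico m 0 = ∅ := Finset.Ico_eq_empty (by omega)
    have h3 : Finset.Ico (m + 1) 0 = ∅ := Finset.Ico_eq_empty (by omega)
    rw [intervalSum, intervalSum, h1, h2, h3, Finset.sum_insert (by simp)]
    simp only [Finset.sum_empty, sub_zero, add_comm]
  · have h1 : Finset.Ico m 0 = insert m (Finset.Ico (m + 1) 0) := by
      ext i; simp only [Finset.mem_Ico, Finset.mem_insert]; omega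
    have h2 : Finset.Ico 0 m = ∅ := Finset.Ico_eq_empty (by omega)
    have h3 : Finset.Ico 0 (m + 1) = ∅ := Finset.Ico_eq_empty (by omega)
    rw [intervalSum, intervalSum, h1, h2, h3, Finset.sum_insert (by simp)]
    simp only [Finset.sum_empty, zero_sub]
    abel

theorem map_intervalSum {N : Type*} [AddCommGroup N] (φ : M →+ N) (g : ℤ → M) (m : ℤ) :
    φ (intervalSum g m) = intervalSum (fun i => φ (g i)) m := by
  simp [intervalSum]

/-- The sign convention for negative m makes telescoping uniform, so powers of t⁻¹ need no separate
treatment. -/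
theorem intervalSum_telescope (g : ℤ → M) (m : ℤ) :
    intervalSum (fun i => g (i + 1) - g i) m = g m - g 0 := by
  induction m with
  | zero => simp
  | succ m ih => rw [intervalSum_add_one, ih]; abel
  | pred m ih =>
    have h := intervalSum_add_one (fun i => g (i + 1) - g i) (-m - 1)
    rw [sub_add_cancel, ih] at h
    rw [eq_sub_of_add_eq h.symm]
    abel

end IntervalSum

namespace PareigisElements

open EnvelopingAlgebra

variable {k A : Type*} [CommRing k] [Ring A] [Algebra k A] (P : PareigisElements k A)

/-- The element `∑_{i<m} (-1)^{n(m-1-i)} tⁱ ⊗ tᵐ⁻¹⁻ⁱ` of the enveloping algebra. -/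
noncomputable def diffQuot (n m : ℤ) : EnvelopingAlgebra k A :=
  intervalSum (fun i => intSign k (n * (m - 1 - i)) • biTmul k A (P.tPow i) (P.tPow (m - 1 - i))) m

/-- Splitting off the last summand leaves each remaining one with an extra right factor t and an
extra sign (−1)ⁿ. This recursion is what makes the contraction of the small resolution undo
multiplication by `tDiff`. -/
theorem diffQuot_add_one (n m : ℤ) : P.diffQuot n (m + 1) =
    biTmul k A (P.tPow m) 1 + intSign k n • (biTmul k A 1 (P.tPow 1) * P.diffQuot n m) := by
  have h := map_intervalSum (((Algebra.lsmul k k (EnvelopingAlgebra k A) (intSign k n)) ∘ₗ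
    LinearMap.mulLeft k (biTmul k A 1 (P.tPow 1))).toAddMonoidHom)
    (fun i => intSign k (n * (m - 1 - i)) • biTmul k A (P.tPow i) (P.tPow (m - 1 - i))) m
  simp only [LinearMap.toAddMonoidHom_coe, LinearMap.comp_apply, LinearMap.mulLeft_apply,
    Algebra.lsmul_coe] at h
  rw [diffQuot, diffQuot, h, intervalSum_add_one, add_comm]
  congr 1
  · rw [show m + 1 - 1 - m = 0 by ring]
    simp
  · congr 1
    funext i
    rw [mul_smul_comm, biTmul_mul_biTmul, one_mul, ← tPow_add, smul_smul, ← intSign_add]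
    congr 3 <;> ring

/-- A telescoping geometric sum: the element is the quotient of tᵐ ⊗ 1 − (−1)ⁿᵐ 1 ⊗ tᵐ by t ⊗ 1 −
(−1)ⁿ 1 ⊗ t. -/
theorem diffQuot_mul_sub (n m : ℤ) :
    P.diffQuot n m * (biTmul k A (P.tPow 1) 1 - intSign k n • biTmul k A 1 (P.tPow 1)) =
      biTmul k A (P.tPow m) 1 - intSign k (n * m) • biTmul k A 1 (P.tPow m) := by
  have h := map_intervalSum (LinearMap.mulRight k
    (biTmul k A (P.tPow 1) 1 - intSign k n • biTmul k A 1 (P.tPow 1))).toAddMonoidHom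
    (fun i => intSign k (n * (m - 1 - i)) • biTmul k A (P.tPow i) (P.tPow (m - 1 - i))) m
  simp only [LinearMap.toAddMonoidHom_coe, LinearMap.mulRight_apply] at h
  have h2 := intervalSum_telescope
    (fun i => intSign k (n * (m - i)) • biTmul k A (P.tPow i) (P.tPow (m - i))) m
  rw [diffQuot, h]
  simp only [sub_self, mul_zero, intSign_zero, one_smul, tPow_zero, sub_zero] at h2
  rw [← h2]
  congr 1
  funext i
  rw [mul_sub, smul_mul_assoc, biTmul_mul_biTmul, smul_mul_smul_comm, biTmul_mul_biTmul, ← tPow_add,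
    ← tPow_add,
    mul_one, one_mul, ← intSign_add]
  congr 2 <;> congr 2 <;> ring

/-- Moving s across tⁱ costs (−1)ⁱ, and raising n by one costs (−1)ᵐ⁻¹⁻ⁱ. The product of the two
signs does not depend on i. -/
theorem diffQuot_mul_s_left (n m : ℤ) : P.diffQuot (n + 1) m * biTmul k A P.s 1 =
    -(intSign k m • (biTmul k A P.s 1 * P.diffQuot n m)) := by
  have h := map_intervalSum (LinearMap.mulRight k (biTmul k A P.s 1)).toAddMonoidHom
    (fun i => intSign k ((n + 1) * (m - 1 - i)) • biTmul k A (P.tPow i) (P.tPow (m - 1 - i))) m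
  have h' := map_intervalSum ((Algebra.lsmul k k (EnvelopingAlgebra k A) (intSign k (m + 1))) ∘ₗ
    LinearMap.mulLeft k (biTmul k A P.s 1)).toAddMonoidHom
    (fun i => intSign k (n * (m - 1 - i)) • biTmul k A (P.tPow i) (P.tPow (m - 1 - i))) m
  simp only [LinearMap.toAddMonoidHom_coe, LinearMap.mulRight_apply, LinearMap.comp_apply,
    LinearMap.mulLeft_apply, Algebra.lsmul_coe] at h h'
  rw [← neg_smul, ← intSign_add_one, diffQuot, diffQuot, h, h']
  congr 1
  funext i
  rw [smul_mul_assoc, biTmul_mul_biTmul, tPow_mul_s, map_smul, LinearMap.smul_apply, mul_smul_comm,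
    biTmul_mul_biTmul, smul_smul, smul_smul, ← intSign_add, ← intSign_add, mul_one, one_mul]
  congr 1
  refine intSign_congr k ⟨-1, by ring⟩

/-- Here s crosses tᵐ⁻¹⁻ⁱ, and the resulting sign is exactly the one by which the twists n + 1 and n
differ. -/
theorem diffQuot_mul_s_right (n m : ℤ) : P.diffQuot (n + 1) m * biTmul k A 1 P.s =
    biTmul k A 1 P.s * P.diffQuot n m := by
  have h := map_intervalSum (LinearMap.mulRight k (biTmul k A 1 P.s)).toAddMonoidHom
    (fun i => intSign k ((n + 1) * (m - 1 - i)) • biTmul k A (P.tPow i) (P.tPow (m - 1 - i))) m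
  have h' := map_intervalSum (LinearMap.mulLeft k (biTmul k A 1 P.s)).toAddMonoidHom
    (fun i => intSign k (n * (m - 1 - i)) • biTmul k A (P.tPow i) (P.tPow (m - 1 - i))) m
  simp only [LinearMap.toAddMonoidHom_coe, LinearMap.mulRight_apply,
    LinearMap.mulLeft_apply] at h h'
  rw [diffQuot, diffQuot, h, h']
  congr 1
  funext i
  rw [smul_mul_assoc, biTmul_mul_biTmul, mul_smul_comm, biTmul_mul_biTmul, tPow_mul_s, map_smul,
    smul_smul, ← intSign_add, mul_one, one_mul]
  congr 1
  refine intSign_congr k ⟨0, by ring⟩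

end PareigisElements

/-! ### The small resolution -/

/-- Generators of the small resolution of Pareigis' algebra: `x n` in degree `n` and `y n` in
degree `n + 1`. -/
inductive ResGen : ℕ → Type
  | x (n : ℕ) : ResGen n
  | y (n : ℕ) : ResGen (n + 1)

section FinsuppTensor

/-- The linear map out of `E ⊗ (G →₀ k)` with given restrictions to the summands. -/
noncomputable def finsuppTensorLift {k E G N : Type*} [CommRing k] [AddCommGroup E] [Module k E]
    [AddCommGroup N] [Module k N] (γ : G → E →ₗ[k] N) : E ⊗[k] (G →₀ k) →ₗ[k] N :=
  TensorProduct.lift (Finsupp.linearCombination k γ).flip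

@[simp]
theorem finsuppTensorLift_tmul_single {k E G N : Type*} [CommRing k] [AddCommGroup E]
    [Module k E] [AddCommGroup N] [Module k N] (γ : G → E →ₗ[k] N) (e : E) (g : G) :
    finsuppTensorLift γ (e ⊗ₜ Finsupp.single g 1) = γ g e := by
  simp [finsuppTensorLift]

theorem finsuppTensor_hom_ext {k E G N : Type*} [CommRing k] [AddCommGroup E]
    [Module k E] [AddCommGroup N] [Module k N] {φ ψ : E ⊗[k] (G →₀ k) →ₗ[k] N}
    (h : ∀ e g, φ (e ⊗ₜ Finsupp.single g 1) = ψ (e ⊗ₜ Finsupp.single g 1)) : φ = ψ := by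
  refine TensorProduct.ext (LinearMap.ext fun e => Finsupp.lhom_ext' fun g =>
    LinearMap.ext_ring (h e g))

end FinsuppTensor

namespace PareigisElements

open EnvelopingAlgebra

variable {k A : Type*} [CommRing k] [Ring A] [Algebra k A] (P : PareigisElements k A)

variable (k A) in
/-- The modules of the small resolution. -/
abbrev Res (n : ℕ) : Type _ := EnvelopingAlgebra k A ⊗[k] (ResGen n →₀ k)

variable (k A) in
/-- The inclusion of the summand generated by `x n`. -/
noncomputable def resX (n : ℕ) : EnvelopingAlgebra k A →ₗ[EnvelopingAlgebra k A] Res k A n :=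
  LinearMap.toSpanSingleton _ _ (1 ⊗ₜ Finsupp.single (ResGen.x n) 1)

variable (k A) in
/-- The inclusion of the summand generated by `y n`. -/
noncomputable def resY (n : ℕ) :
    EnvelopingAlgebra k A →ₗ[EnvelopingAlgebra k A] Res k A (n + 1) :=
  LinearMap.toSpanSingleton _ _ (1 ⊗ₜ Finsupp.single (ResGen.y n) 1)

theorem tmul_x (n : ℕ) (e : EnvelopingAlgebra k A) :
    (e ⊗ₜ Finsupp.single (ResGen.x n) 1 : Res k A n) = resX k A n e :=
  tmul_eq_smul_one_tmul _ _

theorem tmul_y (n : ℕ) (e : EnvelopingAlgebra k A) :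
    (e ⊗ₜ Finsupp.single (ResGen.y n) 1 : Res k A (n + 1)) = resY k A n e :=
  tmul_eq_smul_one_tmul _ _

theorem smul_resX (n : ℕ) (e e' : EnvelopingAlgebra k A) :
    e • resX k A n e' = resX k A n (e * e') := by
  rw [← map_smul, smul_eq_mul]

theorem smul_resY (n : ℕ) (e e' : EnvelopingAlgebra k A) :
    e • resY k A n e' = resY k A n (e * e') := by
  rw [← map_smul, smul_eq_mul]

theorem resX_smul (n : ℕ) (c : k) (e : EnvelopingAlgebra k A) :
    resX k A n (c • e) = c • resX k A n e :=
  ((resX k A n).restrictScalars k).map_smul c e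

theorem resY_smul (n : ℕ) (c : k) (e : EnvelopingAlgebra k A) :
    resY k A n (c • e) = c • resY k A n e :=
  ((resY k A n).restrictScalars k).map_smul c e

/-- The coefficient `s ⊗ 1 - (-1)ⁿ 1 ⊗ s`. -/
noncomputable def sDiff (n : ℤ) : EnvelopingAlgebra k A :=
  biTmul k A P.s 1 - intSign k n • biTmul k A 1 P.s

/-- The coefficient `t ⊗ 1 - (-1)ⁿ 1 ⊗ t`. -/
noncomputable def tDiff (n : ℤ) : EnvelopingAlgebra k A :=
  biTmul k A (P.tPow 1) 1 - intSign k n • biTmul k A 1 (P.tPow 1)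

/-- The differential of the small resolution on generators. -/
noncomputable def resDGen : ∀ n : ℕ, ResGen (n + 1) → Res k A n
  | 0, .x _ => resX k A 0 (P.sDiff 0)
  | 0, .y _ => resX k A 0 (P.tDiff 0)
  | n + 1, .x _ => resX k A (n + 1) (P.sDiff (n + 1))
  | n + 1, .y _ => resX k A (n + 1) (P.tDiff (n + 1)) + resY k A n (P.sDiff (n + 1))

/-- The differential of the small resolution. -/
noncomputable def resD (n : ℕ) : Res k A (n + 1) →ₗ[EnvelopingAlgebra k A] Res k A n :=
  freeLift (Finsupp.linearCombination k (P.resDGen n))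

theorem resD_x (n : ℕ) (e : EnvelopingAlgebra k A) :
    P.resD n (resX k A (n + 1) e) = resX k A n (e * P.sDiff n) := by
  rw [← tmul_x, resD, freeLift_tmul, Finsupp.linearCombination_single, one_smul]
  cases n with
  | zero => exact smul_resX _ _ _
  | succ n => push_cast; exact smul_resX _ _ _

theorem resD_y_zero (e : EnvelopingAlgebra k A) :
    P.resD 0 (resY k A 0 e) = resX k A 0 (e * P.tDiff 0) := by
  rw [← tmul_y, resD, freeLift_tmul, Finsupp.linearCombination_single, one_smul]
  exact smul_resX _ _ _

theorem resD_y_succ (n : ℕ) (e : EnvelopingAlgebra k A) :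
    P.resD (n + 1) (resY k A (n + 1) e) =
      resX k A (n + 1) (e * P.tDiff (n + 1)) + resY k A n (e * P.sDiff (n + 1)) := by
  rw [← tmul_y, resD, freeLift_tmul, Finsupp.linearCombination_single, one_smul]
  exact (smul_add _ _ _).trans (congrArg₂ _ (smul_resX _ _ _) (smul_resY _ _ _))

/-- The factors are the sum and the difference, in some order, of the commuting elements s ⊗ 1 and 1
⊗ s, both of square zero. -/
theorem sDiff_mul_sDiff (n : ℤ) : P.sDiff (n + 1) * P.sDiff n = 0 := by
  simp only [sDiff, sub_mul, mul_sub, smul_mul_assoc, mul_smul_comm, biTmul_mul_biTmul, s_mul_s,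
    mul_one, one_mul, intSign_add_one, map_zero, LinearMap.zero_apply, smul_zero, neg_smul, neg_mul,
    smul_neg, smul_sub]
  abel

/-- The one-sided terms cancel because ts = −st; the mixed terms cancel because the sign in `sDiff`
and `tDiff` alternates with n. -/
theorem tDiff_mul_sDiff (n : ℤ) :
    P.tDiff (n + 1) * P.sDiff n + P.sDiff (n + 1) * P.tDiff n = 0 := by
  have h : P.tPow 1 * P.s = -(P.s * P.tPow 1) := by rw [tPow_mul_s]; simp
  simp only [tDiff, sDiff, sub_mul, mul_sub, smul_mul_assoc, mul_smul_comm, biTmul_mul_biTmul, h,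
    mul_one, one_mul, intSign_add_one, map_neg, LinearMap.neg_apply, smul_neg, neg_smul,
    neg_mul, smul_sub]
  abel

theorem resD_resD (n : ℕ) (z : Res k A (n + 2)) : P.resD n (P.resD (n + 1) z) = 0 := by
  have key : (P.resD n ∘ₗ P.resD (n + 1)).restrictScalars k = 0 := by
    refine finsuppTensor_hom_ext fun e g => ?_
    change P.resD n (P.resD (n + 1) _) = 0
    cases g with
    | x =>
      rw [tmul_x, resD_x, resD_x, mul_assoc]
      push_cast
      rw [sDiff_mul_sDiff, mul_zero, map_zero]
    | y =>
      rw [tmul_y, resD_y_succ, map_add, resD_x]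
      cases n with
      | zero =>
        rw [resD_y_zero, ← map_add, mul_assoc, mul_assoc, ← mul_add]
        have := P.tDiff_mul_sDiff 0
        rw [zero_add] at this
        push_cast
        rw [this, mul_zero, map_zero]
      | succ n =>
        rw [resD_y_succ, ← add_assoc, ← map_add, mul_assoc, mul_assoc, ← mul_add]
        push_cast
        rw [tDiff_mul_sDiff, mul_assoc, sDiff_mul_sDiff, mul_zero, map_zero, map_zero, add_zero]
  exact LinearMap.congr_fun key z

/-- The map `p ⊗ q ↦ φ(p) q`. -/
noncomputable def rightExtend {V : Type*} [AddCommGroup V] [Module k V]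
    (φ : A →ₗ[k] EnvelopingAlgebra k A ⊗[k] V) :
    EnvelopingAlgebra k A →ₗ[k] EnvelopingAlgebra k A ⊗[k] V :=
  EnvelopingAlgebra.lift
    (((Algebra.lsmul k k (EnvelopingAlgebra k A ⊗[k] V)).toLinearMap ∘ₗ biTmul k A 1).flip ∘ₗ φ)

theorem rightExtend_biTmul {V : Type*} [AddCommGroup V] [Module k V]
    (φ : A →ₗ[k] EnvelopingAlgebra k A ⊗[k] V) (p q : A) :
    rightExtend φ (biTmul k A p q) = biTmul k A 1 q • φ p := rfl

theorem rightExtend_mul {V : Type*} [AddCommGroup V] [Module k V]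
    (φ : A →ₗ[k] EnvelopingAlgebra k A ⊗[k] V) (q : A) (e : EnvelopingAlgebra k A) :
    rightExtend φ (biTmul k A 1 q * e) = biTmul k A 1 q • rightExtend φ e := by
  induction e using EnvelopingAlgebra.induction_on with
  | zero => simp
  | mk p q' =>
    rw [biTmul_mul_biTmul, rightExtend_biTmul, rightExtend_biTmul, smul_smul, biTmul_mul_biTmul,
      one_mul, one_mul]
  | add x y hx hy => rw [mul_add, map_add, hx, hy, map_add, smul_add]

end PareigisElements

/-! ### The contraction of the small resolution -/

/-- Generators of an algebra satisfying the relations of Pareigis' algebra, such that the `tᵐ` and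
`s tᵐ` form a basis. -/
structure PareigisBasis (k A : Type*) [CommRing k] [Ring A] [Algebra k A] extends
    PareigisElements k A where
  /-- the basis of the `tᵐ` and `s tᵐ` -/
  basis : Module.Basis (ℤ ⊕ ℤ) k A
  basis_eq : ⇑basis = toPareigisElements.monomial

/-- The basis of Pareigis' algebra. -/
noncomputable def PareigisAlgebra.monomialBasis (k : Type*) [CommRing k] :
    PareigisBasis k (PareigisAlgebra k) where
  toPareigisElements := PareigisAlgebra.elements k
  basis := Module.Basis.mk (PareigisAlgebra.linearIndependent_monomial k)
    (PareigisAlgebra.span_monomial k)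
  basis_eq := Module.Basis.coe_mk _ _

namespace PareigisBasis

open EnvelopingAlgebra PareigisElements

variable {k A : Type*} [CommRing k] [Ring A] [Algebra k A] (P : PareigisBasis k A)

theorem basis_inl (m : ℤ) : P.basis (Sum.inl m) = P.tPow m := by rw [P.basis_eq]; rfl

theorem basis_inr (m : ℤ) : P.basis (Sum.inr m) = P.s * P.tPow m := by rw [P.basis_eq]; rfl

theorem hom_ext {N : Type*} [AddCommGroup N] [Module k N] {φ ψ : A →ₗ[k] N}
    (h1 : ∀ m, φ (P.tPow m) = ψ (P.tPow m))
    (h2 : ∀ m, φ (P.s * P.tPow m) = ψ (P.s * P.tPow m)) : φ = ψ := by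
  refine P.basis.ext fun m => ?_
  cases m with
  | inl m => rw [basis_inl, h1]
  | inr m => rw [basis_inr, h2]

/-- The linear map out of `A` with given values on `tᵐ` and `s tᵐ`. -/
noncomputable def lift {N : Type*} [AddCommGroup N] [Module k N] (u v : ℤ → N) : A →ₗ[k] N :=
  P.basis.constr k (Sum.elim u v)

@[simp]
theorem lift_tPow {N : Type*} [AddCommGroup N] [Module k N] (u v : ℤ → N) (m : ℤ) :
    P.lift u v (P.tPow m) = u m := by
  rw [← basis_inl, lift, Module.Basis.constr_basis]
  rfl

@[simp]
theorem lift_s_mul {N : Type*} [AddCommGroup N] [Module k N] (u v : ℤ → N) (m : ℤ) :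
    P.lift u v (P.s * P.tPow m) = v m := by
  rw [← basis_inr, lift, Module.Basis.constr_basis]
  rfl

/-- The contraction of the small resolution on the summand generated by `x n`. -/
noncomputable def resContractionX (n : ℕ) : A →ₗ[k] Res k A (n + 1) :=
  P.lift (fun m => resY k A n (P.diffQuot n m))
    (fun m => resY k A n (biTmul k A P.s 1 * P.diffQuot n m) +
      intSign k (n * m) • resX k A (n + 1) (biTmul k A 1 (P.tPow m)))

/-- The contraction of the small resolution on generators. -/
noncomputable def resContractionGen : ∀ n : ℕ, ResGen n → EnvelopingAlgebra k A →ₗ[k]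
    Res k A (n + 1)
  | _, .x n => rightExtend (P.resContractionX n)
  | _, .y _ => 0

/-- The contraction of the small resolution. -/
noncomputable def resContraction (n : ℕ) : Res k A n →ₗ[k] Res k A (n + 1) :=
  finsuppTensorLift (P.resContractionGen n)

theorem resContraction_x (n : ℕ) (e : EnvelopingAlgebra k A) :
    P.resContraction n (resX k A n e) = rightExtend (P.resContractionX n) e := by
  rw [← tmul_x, resContraction, finsuppTensorLift_tmul_single]
  rfl

theorem resContraction_y (n : ℕ) (e : EnvelopingAlgebra k A) :
    P.resContraction (n + 1) (resY k A n e) = 0 := by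
  rw [← tmul_y, resContraction, finsuppTensorLift_tmul_single]
  rfl

theorem resContraction_smul (n : ℕ) (q : A) (z : Res k A n) :
    P.resContraction n (biTmul k A 1 q • z) = biTmul k A 1 q • P.resContraction n z := by
  have key : P.resContraction n ∘ₗ
      (Algebra.lsmul k k (Res k A n) (biTmul k A 1 q) : Res k A n →ₗ[k] Res k A n) =
      (Algebra.lsmul k k (Res k A (n + 1)) (biTmul k A 1 q) : _ →ₗ[k] Res k A (n + 1)) ∘ₗ
        P.resContraction n := by
    refine finsuppTensor_hom_ext fun e g => ?_
    change P.resContraction n (biTmul k A 1 q • (e ⊗ₜ Finsupp.single g 1)) =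
      biTmul k A 1 q • P.resContraction n (e ⊗ₜ Finsupp.single g 1)
    cases g with
    | x => rw [tmul_x, smul_resX, resContraction_x, resContraction_x, rightExtend_mul]
    | y => rw [tmul_y, smul_resY, resContraction_y, resContraction_y, smul_zero]
  exact LinearMap.congr_fun key z

theorem resContraction_x_tPow (n : ℕ) (m : ℤ) :
    P.resContraction n (resX k A n (biTmul k A (P.tPow m) 1)) = resY k A n (P.diffQuot n m) := by
  rw [resContraction_x, rightExtend_biTmul, biTmul_one_one, one_smul, resContractionX, lift_tPow]

theorem resContraction_x_s_mul (n : ℕ) (m : ℤ) :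
    P.resContraction n (resX k A n (biTmul k A (P.s * P.tPow m) 1)) =
      resY k A n (biTmul k A P.s 1 * P.diffQuot n m) +
      intSign k (n * m) • resX k A (n + 1) (biTmul k A 1 (P.tPow m)) := by
  rw [resContraction_x, rightExtend_biTmul, biTmul_one_one, one_smul, resContractionX, lift_s_mul]

/-- As a right A-module the enveloping algebra is free on the basis of its left factor, so
right-linear maps need only be compared on tᵐ ⊗ 1 and s tᵐ ⊗ 1. -/
theorem enveloping_hom_ext {N : Type*} [AddCommGroup N] [Module k N]
    [Module (EnvelopingAlgebra k A) N] {φ ψ : EnvelopingAlgebra k A →ₗ[k] N}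
    (hφ : ∀ q e, φ (biTmul k A 1 q * e) = biTmul k A 1 q • φ e)
    (hψ : ∀ q e, ψ (biTmul k A 1 q * e) = biTmul k A 1 q • ψ e)
    (h1 : ∀ m, φ (biTmul k A (P.tPow m) 1) = ψ (biTmul k A (P.tPow m) 1))
    (h2 : ∀ m, φ (biTmul k A (P.s * P.tPow m) 1) = ψ (biTmul k A (P.s * P.tPow m) 1)) : φ = ψ := by
  have key : φ ∘ₗ (biTmul k A).flip 1 = ψ ∘ₗ (biTmul k A).flip 1 := P.hom_ext h1 h2
  refine EnvelopingAlgebra.hom_ext fun p q => ?_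
  have h := LinearMap.congr_fun key p
  simp only [LinearMap.comp_apply, LinearMap.flip_apply] at h
  have h' : biTmul k A p q = biTmul k A 1 q * biTmul k A p 1 := by
    rw [biTmul_mul_biTmul, one_mul, one_mul]
  rw [h', hφ, hψ, h]

/-- The contraction inverts multiplication by `t ⊗ 1 - (-1)ⁿ 1 ⊗ t`. -/
theorem resContraction_x_mul_tDiff (n : ℕ) (e : EnvelopingAlgebra k A) :
    P.resContraction n (resX k A n (e * P.tDiff n)) = resY k A n e := by
  refine LinearMap.congr_fun (f := P.resContraction n ∘ₗ (resX k A n).restrictScalars k ∘ₗ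
    LinearMap.mulRight k (P.tDiff n)) (g := (resY k A n).restrictScalars k)
    (P.enveloping_hom_ext (fun q e => ?_) (fun q e => ?_) (fun m => ?_) fun m => ?_) e
  · change P.resContraction n (resX k A n (biTmul k A 1 q * e * P.tDiff n)) =
      biTmul k A 1 q • P.resContraction n (resX k A n (e * P.tDiff n))
    rw [mul_assoc, ← smul_resX, resContraction_smul]
  · exact (smul_resY _ _ _).symm
  · change P.resContraction n (resX k A n (biTmul k A (P.tPow m) 1 * P.tDiff n)) = _
    -- The product is written as a left basis element minus a right multiple of one, so that right
    -- linearity applies and `diffQuot_add_one` finishes.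
    have h : biTmul k A (P.tPow m) 1 * P.tDiff n = biTmul k A (P.tPow (m + 1)) 1 -
        intSign k n • (biTmul k A 1 (P.tPow 1) * biTmul k A (P.tPow m) 1) := by
      rw [tDiff, mul_sub, mul_smul_comm, biTmul_mul_biTmul, biTmul_mul_biTmul, biTmul_mul_biTmul,
        tPow_add]
      simp only [mul_one, one_mul]
    rw [h, map_sub, resX_smul, ← smul_resX, map_sub, map_smul, resContraction_smul,
      resContraction_x_tPow, resContraction_x_tPow, smul_resY, ← resY_smul, ← map_sub,
      diffQuot_add_one, add_sub_cancel_right]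
    rfl
  · change P.resContraction n (resX k A n (biTmul k A (P.s * P.tPow m) 1 * P.tDiff n)) = _
    have h : biTmul k A (P.s * P.tPow m) 1 * P.tDiff n = biTmul k A (P.s * P.tPow (m + 1)) 1 -
        intSign k n • (biTmul k A 1 (P.tPow 1) * biTmul k A (P.s * P.tPow m) 1) := by
      rw [tDiff, mul_sub, mul_smul_comm, biTmul_mul_biTmul, biTmul_mul_biTmul, biTmul_mul_biTmul,
        tPow_add, mul_assoc]
      simp only [mul_one, one_mul]
    have h3 : biTmul k A 1 (P.tPow 1) * biTmul k A 1 (P.tPow m) =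
      biTmul k A 1 (P.tPow (m + 1)) := by
      rw [biTmul_mul_biTmul, one_mul, tPow_add]
    have h4 : biTmul k A 1 (P.tPow 1) * biTmul k A P.s 1 =
        biTmul k A P.s 1 * biTmul k A 1 (P.tPow 1) := by
      rw [biTmul_mul_biTmul, biTmul_mul_biTmul]; simp only [mul_one, one_mul]
    have h5 : biTmul k A P.s 1 * biTmul k A (P.tPow m) 1 = biTmul k A (P.s * P.tPow m) 1 := by
      rw [biTmul_mul_biTmul, one_mul]
    rw [h, map_sub, resX_smul, ← smul_resX, map_sub, map_smul, resContraction_smul,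
      resContraction_x_s_mul, resContraction_x_s_mul, smul_add, smul_resY,
      smul_comm _ (intSign k _),
      smul_resX, h3, smul_add, smul_smul, ← intSign_add, ← resY_smul, diffQuot_add_one, mul_add, h5,
      ← mul_assoc, h4, mul_assoc, mul_smul_comm, map_add]
    rw [show (n : ℤ) * (m + 1) = n + n * m by ring]
    exact (add_sub_add_right_eq_sub _ _ _).trans (add_sub_cancel_right _ _)

/-- On the y-summand the contraction vanishes, and the claim is that it inverts `tDiff`. On the
x-summand, right linearity leaves the elements tᵐ and s tᵐ, where one compares the coefficients of
xₙ₊₁ and yₙ separately. -/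
theorem resD_contraction (n : ℕ) (z : Res k A (n + 1)) :
    P.resD (n + 1) (P.resContraction (n + 1) z) + P.resContraction n (P.resD n z) = z := by
  have hx : (P.resD (n + 1)).restrictScalars k ∘ₗ P.resContraction (n + 1) ∘ₗ
      (resX k A (n + 1)).restrictScalars k + P.resContraction n ∘ₗ (P.resD n).restrictScalars k ∘ₗ
      (resX k A (n + 1)).restrictScalars k = (resX k A (n + 1)).restrictScalars k := by
    refine P.enveloping_hom_ext (fun q e => ?_) (fun q e => ?_) (fun m => ?_) fun m => ?_
    · change P.resD (n + 1) (P.resContraction (n + 1) (resX k A (n + 1) _)) +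
        P.resContraction n (P.resD n (resX k A (n + 1) _)) = _ • (P.resD (n + 1) (
          P.resContraction (n + 1) (resX k A (n + 1) _)) +
        P.resContraction n (P.resD n (resX k A (n + 1) _)))
      rw [← smul_resX, resContraction_smul, map_smul, map_smul, resContraction_smul, smul_add]
    · exact (smul_resX _ _ _).symm
    · change P.resD (n + 1) (P.resContraction (n + 1) (resX k A (n + 1) _)) +
        P.resContraction n (P.resD n (resX k A (n + 1) _)) = resX k A (n + 1) _
      have hd : biTmul k A (P.tPow m) 1 * P.sDiff n = intSign k m • biTmul k A (P.s * P.tPow m) 1 -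
          intSign k n • (biTmul k A 1 P.s * biTmul k A (P.tPow m) 1) := by
        rw [sDiff, mul_sub, mul_smul_comm, biTmul_mul_biTmul, biTmul_mul_biTmul, biTmul_mul_biTmul,
          tPow_mul_s, map_smul, LinearMap.smul_apply]
        simp only [mul_one, one_mul]
      -- The coefficient of yₙ, which must vanish; `hX` below is the coefficient of xₙ₊₁, a
      -- telescoping sum whose far end is cancelled by the x-part of the contraction of s tᵐ.
      have hY : P.diffQuot (n + 1) m * P.sDiff (n + 1) +
          (intSign k m • (biTmul k A P.s 1 * P.diffQuot n m) -
            intSign k n • (biTmul k A 1 P.s * P.diffQuot n m)) = 0 := by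
        rw [sDiff, mul_sub, mul_smul_comm, diffQuot_mul_s_left, diffQuot_mul_s_right,
          intSign_add_one, neg_smul]
        abel
      have hX : P.diffQuot (n + 1) m * P.tDiff (n + 1) +
          (intSign k m * intSign k (n * m)) • biTmul k A 1 (P.tPow m) =
            biTmul k A (P.tPow m) 1 := by
        rw [tDiff, diffQuot_mul_sub, ← intSign_add, show ((n : ℤ) + 1) * m = m + n * m by ring,
          sub_add_cancel]
      rw [resContraction_x_tPow, resD_y_succ, resD_x, hd, map_sub, map_sub, resX_smul, resX_smul,
        map_smul, map_smul, ← smul_resX n (biTmul k A 1 P.s), resContraction_smul,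
        resContraction_x_tPow,
        resContraction_x_s_mul, smul_add, smul_smul, smul_resY, ← resX_smul, ← resY_smul,
        ← resY_smul]
      push_cast
      conv_rhs => rw [← hX, map_add, ← add_zero (_ + _), ← map_zero (resY k A n), ← hY, map_add,
        map_sub]
      abel
    · change P.resD (n + 1) (P.resContraction (n + 1) (resX k A (n + 1) _)) +
        P.resContraction n (P.resD n (resX k A (n + 1) _)) = resX k A (n + 1) _
      have hd : biTmul k A (P.s * P.tPow m) 1 * P.sDiff n =
          -(intSign k n • (biTmul k A 1 P.s * biTmul k A (P.s * P.tPow m) 1)) := by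
        rw [sDiff, mul_sub, mul_smul_comm, biTmul_mul_biTmul, biTmul_mul_biTmul, biTmul_mul_biTmul,
          s_mul_tPow_mul_s, map_zero, LinearMap.zero_apply, zero_sub]
        simp only [mul_one, one_mul]
      have hss : biTmul k A P.s 1 * biTmul k A P.s 1 = 0 := by
        rw [biTmul_mul_biTmul, s_mul_s, map_zero, LinearMap.zero_apply]
      have hss' : biTmul k A P.s 1 * biTmul k A 1 P.s = biTmul k A 1 P.s * biTmul k A P.s 1 := by
        rw [biTmul_mul_biTmul, biTmul_mul_biTmul]; simp only [mul_one, one_mul]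
      have hY : biTmul k A P.s 1 * P.diffQuot (n + 1) m * P.sDiff (n + 1) -
          intSign k n • (biTmul k A 1 P.s * (biTmul k A P.s 1 * P.diffQuot n m)) = 0 := by
        rw [sDiff, mul_assoc, mul_sub (P.diffQuot _ _), mul_smul_comm, diffQuot_mul_s_left,
          diffQuot_mul_s_right, intSign_add_one, neg_smul, mul_sub, mul_neg, mul_neg, mul_smul_comm,
          mul_smul_comm, ← mul_assoc, ← mul_assoc, ← mul_assoc, hss, hss', zero_mul, smul_zero]
        abel
      have hX : biTmul k A P.s 1 * P.diffQuot (n + 1) m * P.tDiff (n + 1) +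
          intSign k ((n + 1) * m) • (biTmul k A 1 (P.tPow m) * P.sDiff (n + 1)) -
          (intSign k n * intSign k (n * m)) • (biTmul k A 1 P.s * biTmul k A 1 (P.tPow m)) =
            biTmul k A (P.s * P.tPow m) 1 := by
        rw [tDiff, mul_assoc, diffQuot_mul_sub, sDiff, mul_sub, mul_sub, mul_smul_comm,
          mul_smul_comm, biTmul_mul_biTmul, biTmul_mul_biTmul, biTmul_mul_biTmul, biTmul_mul_biTmul,
          biTmul_mul_biTmul, tPow_mul_s, map_smul, smul_sub, smul_smul, smul_smul, ← intSign_add,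
          ← intSign_add, ← intSign_add, add_comm (n : ℤ) 1, intSign_congr k (a := (1 + n) * m +
          (1 + n)) (b := n + n * m + m + 1) ⟨0, by ring⟩, intSign_add_one]
        simp only [mul_one, one_mul, neg_smul]
        abel
      rw [resContraction_x_s_mul, map_add, ← resX_smul, resD_y_succ, resD_x, resD_x, hd, map_neg,
        map_neg, resX_smul, map_smul, ← smul_resX n (biTmul k A 1 P.s), resContraction_smul,
        resContraction_x_s_mul, smul_add, smul_add, smul_resY, smul_comm _ (intSign k (n * m)),
        smul_resX,
        smul_comm _ (intSign k (n * m)), smul_smul, mul_comm (intSign k (n * m)), ← resY_smul,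
        ← resX_smul, smul_mul_assoc]
      push_cast
      conv_rhs => rw [← hX, map_sub, map_add, ← add_zero (_ - _), ← map_zero (resY k A n), ← hY,
        map_sub]
      abel
  refine LinearMap.congr_fun (f := (P.resD (n + 1)).restrictScalars k ∘ₗ P.resContraction (n + 1) +
    P.resContraction n ∘ₗ (P.resD n).restrictScalars k) (g := LinearMap.id)
    (finsuppTensor_hom_ext fun e g => ?_) z
  change P.resD (n + 1) (P.resContraction (n + 1) (e ⊗ₜ Finsupp.single g 1)) +
    P.resContraction n (P.resD n (e ⊗ₜ Finsupp.single g 1)) = e ⊗ₜ Finsupp.single g 1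
  cases g with
  | x => rw [tmul_x]; exact LinearMap.congr_fun hx e
  | y =>
    rw [tmul_y, resContraction_y, map_zero, zero_add]
    cases n with
    | zero => rw [resD_y_zero]; exact P.resContraction_x_mul_tDiff 0 e
    | succ n =>
      rw [resD_y_succ, map_add, resContraction_y, add_zero]
      exact P.resContraction_x_mul_tDiff (n + 1) e

end PareigisBasis

namespace PareigisBasis

open EnvelopingAlgebra PareigisElements

variable {k A : Type*} [CommRing k] [Ring A] [Algebra k A] (P : PareigisBasis k A)

theorem resD_contraction_zero (p q : A) :
    P.resD 0 (P.resContraction 0 (resX k A 0 (biTmul k A p q))) =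
      resX k A 0 (biTmul k A p q - biTmul k A 1 (p * q)) := by
  have h0 : (biTmul k A 1 q) • P.resD 0 (P.resContraction 0 (resX k A 0 (biTmul k A p 1))) =
      biTmul k A 1 q • resX k A 0 (biTmul k A p 1 - biTmul k A 1 p) := by
    congr 1
    refine LinearMap.congr_fun (f := (P.resD 0).restrictScalars k ∘ₗ P.resContraction 0 ∘ₗ
      (resX k A 0).restrictScalars k ∘ₗ (biTmul k A).flip 1)
      (g := (resX k A 0).restrictScalars k ∘ₗ ((biTmul k A).flip 1 - biTmul k A 1))
      (P.hom_ext (fun m => ?_) fun m => ?_) p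
    · change P.resD 0 (P.resContraction 0 (resX k A 0 (biTmul k A (P.tPow m) 1))) =
        resX k A 0 (biTmul k A (P.tPow m) 1 - biTmul k A 1 (P.tPow m))
      rw [resContraction_x_tPow, resD_y_zero, tDiff]
      have := P.diffQuot_mul_sub 0 m
      push_cast
      rw [this]
      simp
    · change P.resD 0 (P.resContraction 0 (resX k A 0 (biTmul k A (P.s * P.tPow m) 1))) =
        resX k A 0 (biTmul k A (P.s * P.tPow m) 1 - biTmul k A 1 (P.s * P.tPow m))
      have := P.diffQuot_mul_sub 0 m
      rw [resContraction_x_s_mul, map_add, resD_y_zero, ← resX_smul, resD_x, ← map_add, tDiff]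
      push_cast
      rw [mul_assoc, this, sDiff]
      simp [mul_sub, biTmul_mul_biTmul]
  have h1 : biTmul k A 1 q * (biTmul k A p 1) = biTmul k A p q := by
    rw [biTmul_mul_biTmul, one_mul, one_mul]
  have h2 : biTmul k A 1 q * (biTmul k A 1 p) = biTmul k A 1 (p * q) := by
    rw [biTmul_mul_biTmul, one_mul]
  rwa [← map_smul, ← resContraction_smul, smul_resX, smul_resX, mul_sub, h1, h2] at h0

variable (k A) in
/-- The identification of the small resolution with the bar complex in degree `0`. -/
noncomputable def resToBarZero : EnvelopingAlgebra k A ⊗[k] (ResGen 0 →₀ k)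
    →ₗ[EnvelopingAlgebra k A] EnvelopingAlgebra k A ⊗[k] TensorWords k A 0 :=
  freeLift (Finsupp.linearCombination k fun _ => 1 ⊗ₜ PiTensorProduct.tprod k Fin.elim0)

variable (k A) in
/-- The identification of the bar complex with the small resolution in degree `0`. -/
noncomputable def barToResZero : EnvelopingAlgebra k A ⊗[k] TensorWords k A 0
    →ₗ[EnvelopingAlgebra k A] EnvelopingAlgebra k A ⊗[k] (ResGen 0 →₀ k) :=
  freeLift (LinearMap.toSpanSingleton k _ (resX k A 0 1) ∘ₗ
    (PiTensorProduct.isEmptyEquiv (Fin 0)).toLinearMap)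

theorem resToBarZero_x (e : EnvelopingAlgebra k A) :
    resToBarZero k A (resX k A 0 e) = e ⊗ₜ PiTensorProduct.tprod k Fin.elim0 := by
  rw [← tmul_x, resToBarZero, freeLift_tmul, Finsupp.linearCombination_single, one_smul,
    ← tmul_eq_smul_one_tmul]

theorem barToResZero_tmul (e : EnvelopingAlgebra k A) (w : Fin 0 → A) :
    barToResZero k A (e ⊗ₜ PiTensorProduct.tprod k w) = resX k A 0 e := by
  rw [barToResZero, freeLift_tmul, LinearMap.comp_apply, LinearEquiv.coe_coe,
    PiTensorProduct.isEmptyEquiv_apply_tprod, LinearMap.toSpanSingleton_apply, one_smul, smul_resX,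
    mul_one]

theorem word_zero_induction {motive : TensorWords k A 0 → Prop} (w : TensorWords k A 0)
    (smul : ∀ c : k, motive (c • PiTensorProduct.tprod k Fin.elim0)) : motive w := by
  have h : w = (PiTensorProduct.isEmptyEquiv (Fin 0) w) • PiTensorProduct.tprod k Fin.elim0 := by
    apply (PiTensorProduct.isEmptyEquiv (Fin 0)).injective
    rw [map_smul, PiTensorProduct.isEmptyEquiv_apply_tprod, smul_eq_mul, mul_one]
  rw [h]
  exact smul _

theorem resToBarZero_barToResZero (z : EnvelopingAlgebra k A ⊗[k] TensorWords k A 0) :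
    resToBarZero k A (barToResZero k A z) = z := by
  induction z with
  | zero => simp
  | add x y hx hy => simp only [map_add, hx, hy]
  | tmul e w =>
    induction w using word_zero_induction with
    | smul c =>
      rw [← TensorProduct.smul_tmul, barToResZero_tmul, resToBarZero_x]

theorem barToResZero_resToBarZero (z : EnvelopingAlgebra k A ⊗[k] (ResGen 0 →₀ k)) :
    barToResZero k A (resToBarZero k A z) = z := by
  refine LinearMap.congr_fun (f := (barToResZero k A ∘ₗ resToBarZero k A).restrictScalars k)
    (g := LinearMap.id) (finsuppTensor_hom_ext fun e g => ?_) z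
  cases g with
  | x =>
    change barToResZero k A (resToBarZero k A (e ⊗ₜ Finsupp.single (ResGen.x 0) 1)) = _
    rw [tmul_x, resToBarZero_x, barToResZero_tmul, LinearMap.id_apply]

/-- The comparison map from the small resolution to the bar complex. -/
noncomputable def resToBar (n : ℕ) : EnvelopingAlgebra k A ⊗[k] (ResGen n →₀ k)
    →ₗ[EnvelopingAlgebra k A] EnvelopingAlgebra k A ⊗[k] TensorWords k A n :=
  comparison (V := fun n => ResGen n →₀ k) (W := TensorWords k A) (resToBarZero k A) P.resD
    (barContraction k A) n

/-- The comparison map from the bar complex to the small resolution. -/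
noncomputable def barToRes (n : ℕ) : EnvelopingAlgebra k A ⊗[k] TensorWords k A n
    →ₗ[EnvelopingAlgebra k A] EnvelopingAlgebra k A ⊗[k] (ResGen n →₀ k) :=
  comparison (V := TensorWords k A) (W := fun n => ResGen n →₀ k) (barToResZero k A) (barD k A)
    P.resContraction n

theorem resToBar_comm (n : ℕ) (z : EnvelopingAlgebra k A ⊗[k] (ResGen (n + 1) →₀ k)) :
    barD k A n (P.resToBar (n + 1) z) = P.resToBar n (P.resD n z) := by
  refine comparison_comm (V := fun n => ResGen n →₀ k) (W := TensorWords k A) (resToBarZero k A)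
    P.resD (barD k A) (barContraction k A) P.resD_resD (barD_contraction k A) (fun v => ?_) n z
  induction v using Finsupp.induction_linear with
  | zero => simp
  | add x y hx hy => simp only [TensorProduct.tmul_add, map_add, hx, hy]
  | single g c =>
    have hc : (1 : EnvelopingAlgebra k A) ⊗ₜ[k] Finsupp.single g c =
        c • (1 ⊗ₜ[k] Finsupp.single g 1) := by
      rw [← TensorProduct.tmul_smul, Finsupp.smul_single, smul_eq_mul, mul_one]
    rw [hc, LinearMap.map_smul_of_tower, LinearMap.map_smul_of_tower, map_smul,
      LinearMap.map_smul_of_tower]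
    congr 1
    have key (a : A) : barD k A 0 (barContraction k A 0 ((biTmul k A a 1 - biTmul k A 1 a) ⊗ₜ
        PiTensorProduct.tprod k Fin.elim0)) = (biTmul k A a 1 - biTmul k A 1 a) ⊗ₜ
        PiTensorProduct.tprod k Fin.elim0 := by
      rw [TensorProduct.sub_tmul, map_sub, map_sub, barD_contraction_zero, barD_contraction_zero]
      simp
    cases g with
    | x =>
      rw [tmul_x, resD_x, resToBarZero_x, sDiff, Nat.cast_zero, intSign_zero, one_smul, one_mul,
        key]
    | y =>
      rw [tmul_y, resD_y_zero, resToBarZero_x, tDiff, intSign_zero, one_smul, one_mul, key]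

theorem barToRes_comm (n : ℕ) (z : EnvelopingAlgebra k A ⊗[k] TensorWords k A (n + 1)) :
    P.resD n (P.barToRes (n + 1) z) = P.barToRes n (barD k A n z) := by
  refine comparison_comm (V := TensorWords k A) (W := fun n => ResGen n →₀ k) (barToResZero k A)
    (barD k A) P.resD P.resContraction (barD_barD k A) P.resD_contraction (fun v => ?_) n z
  induction v using tensorWords_induction with
  | add x y hx hy => simp only [TensorProduct.tmul_add, map_add, hx, hy]
  | cons a w =>
    induction w using word_zero_induction with
    | smul c =>
      rw [← TensorProduct.smul_tmul, barD_zero_cons, one_smul, map_sub, barToResZero_tmul,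
        barToResZero_tmul, map_sub, map_sub, resD_contraction_zero, resD_contraction_zero]
      simp

/-- The homotopy between the identity of the bar complex and the composite of the comparison
maps. -/
theorem exists_bar_homotopy : ∃ h : ∀ n, EnvelopingAlgebra k A ⊗[k] TensorWords k A n
    →ₗ[EnvelopingAlgebra k A] EnvelopingAlgebra k A ⊗[k] TensorWords k A (n + 1),
    ∀ n z, barD k A (n + 1) (h (n + 1) z) + h n (barD k A n z) =
      z - P.resToBar (n + 1) (P.barToRes (n + 1) z) :=
  ⟨nullHomotopy (V := TensorWords k A) (barD k A) (barContraction k A)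
      fun n => LinearMap.id - P.resToBar n ∘ₗ P.barToRes n,
    nullHomotopy_spec (V := TensorWords k A) (barD k A) (barContraction k A) _ (barD_barD k A)
      (barD_contraction k A)
      (LinearMap.ext fun z => sub_eq_zero.mpr (resToBarZero_barToResZero z).symm)
      fun n z => by
        change barD k A n (z - P.resToBar (n + 1) (P.barToRes (n + 1) z)) =
          barD k A n z - P.resToBar n (P.barToRes n (barD k A n z))
        rw [map_sub, resToBar_comm, barToRes_comm]⟩

/-- The homotopy between the identity of the small resolution and the composite of the comparison
maps. -/
theorem exists_res_homotopy : ∃ h : ∀ n, EnvelopingAlgebra k A ⊗[k] (ResGen n →₀ k)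
    →ₗ[EnvelopingAlgebra k A] EnvelopingAlgebra k A ⊗[k] (ResGen (n + 1) →₀ k),
    ∀ n z, P.resD (n + 1) (h (n + 1) z) + h n (P.resD n z) =
      z - P.barToRes (n + 1) (P.resToBar (n + 1) z) :=
  ⟨nullHomotopy (V := fun n => ResGen n →₀ k) P.resD P.resContraction
      fun n => LinearMap.id - P.barToRes n ∘ₗ P.resToBar n,
    nullHomotopy_spec (V := fun n => ResGen n →₀ k) P.resD P.resContraction _ P.resD_resD
      P.resD_contraction
      (LinearMap.ext fun z => sub_eq_zero.mpr (barToResZero_resToBarZero z).symm)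
      fun n z => by
        change P.resD n (z - P.barToRes (n + 1) (P.resToBar (n + 1) z)) =
          P.resD n z - P.barToRes n (P.resToBar n (P.resD n z))
        rw [map_sub, barToRes_comm, resToBar_comm]⟩

/-- The differential of the small complex computing Hochschild homology. -/
noncomputable def smallD (n : ℕ) : A ⊗[k] (ResGen (n + 1) →₀ k) →ₗ[k] A ⊗[k] (ResGen n →₀ k) :=
  coinvMap (P.resD n)

/-- The cycles of the small complex. -/
noncomputable def smallCycles : ∀ n, Submodule k (A ⊗[k] (ResGen n →₀ k))
  | 0 => ⊤
  | n + 1 => LinearMap.ker (P.smallD n)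

/-- The comparison map from the small complex to the Hochschild complex. -/
noncomputable def smallToHochschild (n : ℕ) : A ⊗[k] (ResGen n →₀ k) →ₗ[k] HochschildChain k A n :=
  (consEquiv k A n).toLinearMap ∘ₗ coinvMap (P.resToBar n)

/-- The comparison map from the Hochschild complex to the small complex. -/
noncomputable def hochschildToSmall (n : ℕ) : HochschildChain k A n →ₗ[k] A ⊗[k] (ResGen n →₀ k) :=
  coinvMap (P.barToRes n) ∘ₗ (consEquiv k A n).symm.toLinearMap

theorem smallToHochschild_comm (n : ℕ) (z : A ⊗[k] (ResGen (n + 1) →₀ k)) :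
    hochschildBoundary k A n (P.smallToHochschild (n + 1) z) =
      P.smallToHochschild n (P.smallD n z) := by
  simp only [smallToHochschild, smallD, LinearMap.comp_apply, LinearEquiv.coe_coe,
    ← consEquiv_coinvMap_barD, coinvMap_comp]
  congr 2
  exact congrArg coinvMap (LinearMap.ext (P.resToBar_comm n))

theorem hochschildToSmall_comm (n : ℕ) (z : HochschildChain k A (n + 1)) :
    P.smallD n (P.hochschildToSmall (n + 1) z) =
      P.hochschildToSmall n (hochschildBoundary k A n z) := by
  obtain ⟨z, rfl⟩ := (consEquiv k A (n + 1)).surjective z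
  simp only [hochschildToSmall, smallD, LinearMap.comp_apply, LinearEquiv.coe_coe,
    ← consEquiv_coinvMap_barD, coinvMap_comp, LinearEquiv.symm_apply_apply]
  congr 1
  exact congrArg coinvMap (LinearMap.ext (P.barToRes_comm n))

theorem smallToHochschild_mem_cycles (n : ℕ) {z : A ⊗[k] (ResGen n →₀ k)}
    (hz : z ∈ P.smallCycles n) : P.smallToHochschild n z ∈ hochschildCycles k A n := by
  cases n with
  | zero => trivial
  | succ n =>
    have hz : P.smallD n z = 0 := hz
    change hochschildBoundary k A n _ = 0
    rw [smallToHochschild_comm, hz, map_zero]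

theorem hochschildToSmall_mem_cycles (n : ℕ) {z : HochschildChain k A n}
    (hz : z ∈ hochschildCycles k A n) : P.hochschildToSmall n z ∈ P.smallCycles n := by
  cases n with
  | zero => trivial
  | succ n =>
    have hz : hochschildBoundary k A n z = 0 := hz
    change P.smallD n _ = 0
    rw [hochschildToSmall_comm, hz, map_zero]

theorem sub_smallToHochschild_mem (n : ℕ) {z : HochschildChain k A n}
    (hz : z ∈ hochschildCycles k A n) :
    z - P.smallToHochschild n (P.hochschildToSmall n z) ∈ hochschildBoundaries k A n := by
  obtain ⟨z, rfl⟩ := (consEquiv k A n).surjective z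
  simp only [hochschildToSmall, smallToHochschild, LinearMap.comp_apply, LinearEquiv.coe_coe,
    LinearEquiv.symm_apply_apply, coinvMap_comp]
  cases n with
  | zero =>
    have h : P.resToBar 0 ∘ₗ P.barToRes 0 = LinearMap.id :=
      LinearMap.ext resToBarZero_barToResZero
    rw [h, coinvMap_id, sub_self]
    exact Submodule.zero_mem _
  | succ n =>
    obtain ⟨h, hh⟩ := P.exists_bar_homotopy
    have hz : hochschildBoundary k A n (consEquiv k A (n + 1) z) = 0 := hz
    rw [← consEquiv_coinvMap_barD, LinearEquiv.map_eq_zero_iff] at hz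
    have key : barD k A (n + 1) ∘ₗ h (n + 1) + h n ∘ₗ barD k A n +
        P.resToBar (n + 1) ∘ₗ P.barToRes (n + 1) = LinearMap.id := by
      refine LinearMap.ext fun z => ?_
      change barD k A (n + 1) (h (n + 1) z) + h n (barD k A n z) +
        P.resToBar (n + 1) (P.barToRes (n + 1) z) = z
      rw [hh, sub_add_cancel]
    refine ⟨consEquiv k A (n + 2) (coinvMap (h (n + 1)) z), ?_⟩
    rw [← consEquiv_coinvMap_barD, ← map_sub, coinvMap_comp]
    congr 1
    have h2 := congrArg (fun Φ => coinvMap Φ z) key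
    simp only [coinvMap_add, coinvMap_id, ← coinvMap_comp (h n), hz, map_zero, add_zero] at h2
    exact eq_sub_of_add_eq h2

theorem sub_hochschildToSmall_mem (n : ℕ) {z : A ⊗[k] (ResGen n →₀ k)}
    (hz : z ∈ P.smallCycles n) :
    z - P.hochschildToSmall n (P.smallToHochschild n z) ∈ LinearMap.range (P.smallD n) := by
  simp only [hochschildToSmall, smallToHochschild, LinearMap.comp_apply, LinearEquiv.coe_coe,
    LinearEquiv.symm_apply_apply, coinvMap_comp]
  cases n with
  | zero =>
    have h : P.barToRes 0 ∘ₗ P.resToBar 0 = LinearMap.id :=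
      LinearMap.ext barToResZero_resToBarZero
    rw [h, coinvMap_id, sub_self]
    exact Submodule.zero_mem _
  | succ n =>
    obtain ⟨h, hh⟩ := P.exists_res_homotopy
    have hz : coinvMap (P.resD n) z = 0 := hz
    have key : P.resD (n + 1) ∘ₗ h (n + 1) + h n ∘ₗ P.resD n +
        P.barToRes (n + 1) ∘ₗ P.resToBar (n + 1) = LinearMap.id := by
      refine LinearMap.ext fun z => ?_
      change P.resD (n + 1) (h (n + 1) z) + h n (P.resD n z) +
        P.barToRes (n + 1) (P.resToBar (n + 1) z) = z
      rw [hh, sub_add_cancel]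
    refine ⟨coinvMap (h (n + 1)) z, ?_⟩
    rw [smallD, coinvMap_comp]
    have h2 := congrArg (fun Φ => coinvMap Φ z) key
    simp only [coinvMap_add, coinvMap_id, ← coinvMap_comp (h n), hz, map_zero, add_zero] at h2
    exact eq_sub_of_add_eq h2

/-- Hochschild homology is the homology of the small complex. -/
theorem exists_hochschildHomology_equiv (n : ℕ) {N : Type*} [AddCommGroup N] [Module k N]
    (Ψ : A ⊗[k] (ResGen n →₀ k) →ₗ[k] N) (Φ : N →ₗ[k] A ⊗[k] (ResGen n →₀ k))
    (hΨΦ : ∀ x, Ψ (Φ x) = x) (hΦ : ∀ x, Φ x ∈ P.smallCycles n)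
    (hΨ : ∀ z, Ψ (P.smallD n z) = 0)
    (h : ∀ z ∈ P.smallCycles n, z - Φ (Ψ z) ∈ LinearMap.range (P.smallD n)) :
    ∃ e : HochschildHomology k A n ≃ₗ[k] N,
      (∀ z : hochschildCycles k A n,
        e (Submodule.Quotient.mk z) = Ψ (P.hochschildToSmall n z)) ∧
      ∀ x, ∃ hx : P.smallToHochschild n (Φ x) ∈ hochschildCycles k A n,
        e (Submodule.Quotient.mk ⟨_, hx⟩) = x := by
  have hΨ' : ∀ z ∈ LinearMap.range (P.smallD n), Ψ z = 0 := by
    rintro _ ⟨z, rfl⟩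
    exact hΨ z
  have hpq (x : N) : Ψ (P.hochschildToSmall n (P.smallToHochschild n (Φ x))) = x := by
    have := hΨ' _ (P.sub_hochschildToSmall_mem n (hΦ x))
    rw [map_sub, hΨΦ, sub_eq_zero] at this
    exact this.symm
  let p : hochschildCycles k A n →ₗ[k] N :=
    Ψ ∘ₗ P.hochschildToSmall n ∘ₗ (hochschildCycles k A n).subtype
  have hker : LinearMap.ker p =
      (hochschildBoundaries k A n).submoduleOf (hochschildCycles k A n) := by
    ext ⟨z, hz⟩
    change Ψ (P.hochschildToSmall n z) = 0 ↔ z ∈ hochschildBoundaries k A n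
    constructor
    · intro h0
      have h1 := P.sub_smallToHochschild_mem n hz
      obtain ⟨w, hw⟩ := h _ (P.hochschildToSmall_mem_cycles n hz)
      rw [h0, map_zero, sub_zero] at hw
      rw [← hw, ← smallToHochschild_comm] at h1
      simpa using Submodule.add_mem _ h1 (LinearMap.mem_range_self _ _ :
        hochschildBoundary k A n (P.smallToHochschild (n + 1) w) ∈ hochschildBoundaries k A n)
    · rintro ⟨w, rfl⟩
      rw [← hochschildToSmall_comm, hΨ]
  have hsurj : Function.Surjective p := fun x =>
    ⟨⟨_, P.smallToHochschild_mem_cycles n (hΦ x)⟩, hpq x⟩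
  refine ⟨(Submodule.quotEquivOfEq _ _ hker.symm).trans (p.quotKerEquivOfSurjective hsurj),
    fun z => rfl, fun x => ⟨P.smallToHochschild_mem_cycles n (hΦ x), hpq x⟩⟩

end PareigisBasis

theorem Int.even_and_not_odd_or (m : ℤ) : Even m ∧ ¬Odd m ∨ Odd m ∧ ¬Even m := by
  rw [Int.not_odd_iff_even, Int.not_even_iff_odd, and_self, and_self]
  exact m.even_or_odd

section Laurent

variable {k : Type*} [CommRing k] {N : Type*} [AddCommGroup N] [Module k N]

/-- The linear map out of the Laurent polynomials with given values on the powers of `T`. -/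
noncomputable def laurentLift (u : ℤ → N) : k[T;T⁻¹] →ₗ[k] N :=
  Finsupp.linearCombination k u ∘ₗ (AddMonoidAlgebra.coeffLinearEquiv k).toLinearMap

@[simp]
theorem laurentLift_T (u : ℤ → N) (m : ℤ) : laurentLift u (LaurentPolynomial.T m : k[T;T⁻¹]) =
    u m := by
  change Finsupp.linearCombination k u (Finsupp.single m 1) = u m
  simp

theorem laurent_hom_ext {φ ψ : k[T;T⁻¹] →ₗ[k] N}
    (h : ∀ m, φ (LaurentPolynomial.T m) = ψ (LaurentPolynomial.T m)) : φ = ψ :=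
  AddMonoidAlgebra.lhom_ext' fun m => LinearMap.ext_ring (h m)

variable (k) in
/-- The projection of `Tᵐ` to the span of the odd powers of `T`. -/
noncomputable def oddT (m : ℤ) : laurentOdd k :=
  if h : Odd m then ⟨LaurentPolynomial.T m, Submodule.subset_span ⟨m, h, rfl⟩⟩ else 0

theorem oddT_of_odd {m : ℤ} (h : Odd m) : (oddT k m : k[T;T⁻¹]) = LaurentPolynomial.T m := by
  simp [oddT, h]

theorem oddT_of_even {m : ℤ} (h : Even m) : oddT k m = 0 := by
  rw [oddT, dif_neg (Int.not_odd_iff_even.mpr h)]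

theorem laurentOdd_hom_ext {φ ψ : laurentOdd k →ₗ[k] N}
    (h : ∀ m, Odd m → φ (oddT k m) = ψ (oddT k m)) : φ = ψ := by
  refine LinearMap.ext fun ⟨x, hx⟩ => ?_
  induction hx using Submodule.span_induction with
  | mem x hx =>
    obtain ⟨m, hm, rfl⟩ := hx
    have := h m hm
    simpa [oddT, hm] using this
  | zero => exact (map_zero φ).trans (map_zero ψ).symm
  | add x y hx hy h1 h2 =>
    exact (map_add φ ⟨x, hx⟩ ⟨y, hy⟩).trans ((congrArg₂ _ h1 h2).trans (map_add ψ _ _).symm)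
  | smul c x hx h1 =>
    exact (map_smul φ c ⟨x, hx⟩).trans ((congrArg _ h1).trans (map_smul ψ _ _).symm)

/-- The linear map out of the span of the odd powers of `T` with given values on these. -/
noncomputable def laurentOddLift (u : ℤ → N) : laurentOdd k →ₗ[k] N :=
  laurentLift u ∘ₗ (laurentOdd k).subtype

theorem laurentOddLift_of_odd (u : ℤ → N) {m : ℤ} (h : Odd m) :
    laurentOddLift u (oddT k m) = u m := by
  simp [laurentOddLift, oddT_of_odd h]

end Laurent

namespace PareigisBasis

open EnvelopingAlgebra PareigisElements

section SmallComplex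

variable {k A : Type*} [CommRing k] [Ring A] [Algebra k A] (P : PareigisBasis k A)

variable (k A) in
/-- The summand of the small complex generated by `x n`. -/
noncomputable def smallX (n : ℕ) : A →ₗ[k] A ⊗[k] (ResGen n →₀ k) :=
  (TensorProduct.mk k A _).flip (Finsupp.single (ResGen.x n) 1)

variable (k A) in
/-- The summand of the small complex generated by `y n`. -/
noncomputable def smallY (n : ℕ) : A →ₗ[k] A ⊗[k] (ResGen (n + 1) →₀ k) :=
  (TensorProduct.mk k A _).flip (Finsupp.single (ResGen.y n) 1)

theorem coinvMk_resX (n : ℕ) (e : EnvelopingAlgebra k A) :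
    coinvMk k A _ (resX k A n e) = smallX k A n (envelopeMul k A e) := by
  rw [← tmul_x]
  rfl

theorem coinvMk_resY (n : ℕ) (e : EnvelopingAlgebra k A) :
    coinvMk k A _ (resY k A n e) = smallY k A n (envelopeMul k A e) := by
  rw [← tmul_y]
  rfl

theorem envelopeMul_sDiff (n : ℤ) (a : A) : envelopeMul k A (biTmul k A 1 a * P.sDiff n) =
    a * P.s - intSign k n • (P.s * a) := by
  simp [sDiff, mul_sub, biTmul_mul_biTmul]

theorem envelopeMul_tDiff (n : ℤ) (a : A) : envelopeMul k A (biTmul k A 1 a * P.tDiff n) =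
    a * P.tPow 1 - intSign k n • (P.tPow 1 * a) := by
  simp [tDiff, mul_sub, biTmul_mul_biTmul]

theorem smallD_smallX (n : ℕ) (a : A) : P.smallD n (smallX k A (n + 1) a) =
    smallX k A n (a * P.s - intSign k n • (P.s * a)) := by
  refine (coinvMap_tmul _ _ _).trans ?_
  rw [tmul_x, resD_x, smul_resX, one_mul, coinvMk_resX, envelopeMul_sDiff]

theorem smallD_smallY_zero (a : A) : P.smallD 0 (smallY k A 0 a) =
    smallX k A 0 (a * P.tPow 1 - P.tPow 1 * a) := by
  refine (coinvMap_tmul _ _ _).trans ?_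
  rw [tmul_y, resD_y_zero, smul_resX, one_mul, coinvMk_resX, envelopeMul_tDiff, intSign_zero,
    one_smul]

theorem smallD_smallY_succ (n : ℕ) (a : A) : P.smallD (n + 1) (smallY k A (n + 1) a) =
    smallX k A (n + 1) (a * P.tPow 1 - intSign k (n + 1) • (P.tPow 1 * a)) +
      smallY k A n (a * P.s - intSign k (n + 1) • (P.s * a)) := by
  refine (coinvMap_tmul _ _ _).trans ?_
  rw [tmul_y, resD_y_succ, smul_add, smul_resX, smul_resY, one_mul, one_mul, map_add, coinvMk_resX,
    coinvMk_resY, envelopeMul_tDiff, envelopeMul_sDiff]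

theorem tPow_one_mul_s_mul (m : ℤ) : P.tPow 1 * (P.s * P.tPow m) = -(P.s * P.tPow (m + 1)) := by
  rw [← mul_assoc, tPow_mul_s, intSign_one, neg_smul, one_smul, neg_mul, mul_assoc, ← tPow_add,
    add_comm]

theorem smallD_smallX_tPow (n : ℕ) (m : ℤ) : P.smallD n (smallX k A (n + 1) (P.tPow m)) =
    (intSign k m - intSign k n) • smallX k A n (P.s * P.tPow m) := by
  rw [smallD_smallX, tPow_mul_s, ← sub_smul, map_smul]

theorem smallD_smallX_s_mul (n : ℕ) (m : ℤ) :
    P.smallD n (smallX k A (n + 1) (P.s * P.tPow m)) = 0 := by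
  rw [smallD_smallX, s_mul_tPow_mul_s, ← mul_assoc, s_mul_s, zero_mul, smul_zero, sub_zero,
    map_zero]

theorem smallD_smallY_zero_tPow (m : ℤ) : P.smallD 0 (smallY k A 0 (P.tPow m)) = 0 := by
  rw [smallD_smallY_zero, ← tPow_add, ← tPow_add, add_comm, sub_self, map_zero]

theorem smallD_smallY_zero_s_mul (m : ℤ) : P.smallD 0 (smallY k A 0 (P.s * P.tPow m)) =
    (2 : k) • smallX k A 0 (P.s * P.tPow (m + 1)) := by
  rw [smallD_smallY_zero, tPow_one_mul_s_mul, mul_assoc, ← tPow_add, sub_neg_eq_add, ← two_smul k,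
    map_smul]

theorem smallD_smallY_succ_tPow (n : ℕ) (m : ℤ) :
    P.smallD (n + 1) (smallY k A (n + 1) (P.tPow m)) =
      (1 - intSign k (n + 1)) • smallX k A (n + 1) (P.tPow (m + 1)) +
        (intSign k m - intSign k (n + 1)) • smallY k A n (P.s * P.tPow m) := by
  rw [smallD_smallY_succ, tPow_mul_s, ← tPow_add, ← tPow_add, add_comm 1 m, ← sub_smul, map_smul,
    map_sub, map_smul]
  module

theorem smallD_smallY_succ_s_mul (n : ℕ) (m : ℤ) :
    P.smallD (n + 1) (smallY k A (n + 1) (P.s * P.tPow m)) =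
      (1 + intSign k (n + 1)) • smallX k A (n + 1) (P.s * P.tPow (m + 1)) := by
  rw [smallD_smallY_succ, tPow_one_mul_s_mul, s_mul_tPow_mul_s, ← mul_assoc P.s P.s, s_mul_s,
    zero_mul, smul_zero, sub_zero, map_zero, add_zero, mul_assoc, ← tPow_add, smul_neg,
    sub_neg_eq_add, map_add, map_smul, add_smul, one_smul]

theorem small_zero_hom_ext {N : Type*} [AddCommGroup N] [Module k N]
    {φ ψ : A ⊗[k] (ResGen 0 →₀ k) →ₗ[k] N}
    (h1 : ∀ m, φ (smallX k A 0 (P.tPow m)) = ψ (smallX k A 0 (P.tPow m)))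
    (h2 : ∀ m, φ (smallX k A 0 (P.s * P.tPow m)) = ψ (smallX k A 0 (P.s * P.tPow m))) :
    φ = ψ := by
  refine finsuppTensor_hom_ext fun a g => ?_
  cases g with
  | x =>
    exact LinearMap.congr_fun (f := φ ∘ₗ smallX k A 0) (g := ψ ∘ₗ smallX k A 0)
      (P.hom_ext h1 h2) a

theorem small_succ_hom_ext {N : Type*} [AddCommGroup N] [Module k N] {n : ℕ}
    {φ ψ : A ⊗[k] (ResGen (n + 1) →₀ k) →ₗ[k] N}
    (h1 : ∀ m, φ (smallX k A (n + 1) (P.tPow m)) = ψ (smallX k A (n + 1) (P.tPow m)))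
    (h2 : ∀ m, φ (smallX k A (n + 1) (P.s * P.tPow m)) =
      ψ (smallX k A (n + 1) (P.s * P.tPow m)))
    (h3 : ∀ m, φ (smallY k A n (P.tPow m)) = ψ (smallY k A n (P.tPow m)))
    (h4 : ∀ m, φ (smallY k A n (P.s * P.tPow m)) = ψ (smallY k A n (P.s * P.tPow m))) :
    φ = ψ := by
  refine finsuppTensor_hom_ext fun a g => ?_
  cases g with
  | x =>
    exact LinearMap.congr_fun (f := φ ∘ₗ smallX k A (n + 1)) (g := ψ ∘ₗ smallX k A (n + 1))
      (P.hom_ext h1 h2) a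
  | y =>
    exact LinearMap.congr_fun (f := φ ∘ₗ smallY k A n) (g := ψ ∘ₗ smallY k A n)
      (P.hom_ext h3 h4) a

/-- The linear map out of the degree `0` part of the small complex with given values on the basis.
-/
noncomputable def smallLiftZero {N : Type*} [AddCommGroup N] [Module k N] (u v : ℤ → N) :
    A ⊗[k] (ResGen 0 →₀ k) →ₗ[k] N :=
  finsuppTensorLift fun _ => P.lift u v

/-- The linear map out of the degree `n + 1` part of the small complex with given values on the
basis. -/
noncomputable def smallLiftSucc {N : Type*} [AddCommGroup N] [Module k N] (n : ℕ)
    (u v u' v' : ℤ → N) : A ⊗[k] (ResGen (n + 1) →₀ k) →ₗ[k] N :=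
  finsuppTensorLift fun g => match g with
    | .x _ => P.lift u v
    | .y _ => P.lift u' v'

section

variable {N : Type*} [AddCommGroup N] [Module k N] (n : ℕ) (u v u' v' : ℤ → N) (m : ℤ)

@[simp]
theorem smallLiftZero_tPow : P.smallLiftZero u v (smallX k A 0 (P.tPow m)) = u m :=
  (finsuppTensorLift_tmul_single _ _ _).trans (P.lift_tPow u v m)

@[simp]
theorem smallLiftZero_s_mul : P.smallLiftZero u v (smallX k A 0 (P.s * P.tPow m)) = v m :=
  (finsuppTensorLift_tmul_single _ _ _).trans (P.lift_s_mul u v m)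

@[simp]
theorem smallLiftSucc_smallX_tPow :
    P.smallLiftSucc n u v u' v' (smallX k A (n + 1) (P.tPow m)) = u m :=
  (finsuppTensorLift_tmul_single _ _ _).trans (P.lift_tPow u v m)

@[simp]
theorem smallLiftSucc_smallX_s_mul :
    P.smallLiftSucc n u v u' v' (smallX k A (n + 1) (P.s * P.tPow m)) = v m :=
  (finsuppTensorLift_tmul_single _ _ _).trans (P.lift_s_mul u v m)

@[simp]
theorem smallLiftSucc_smallY_tPow :
    P.smallLiftSucc n u v u' v' (smallY k A n (P.tPow m)) = u' m :=
  (finsuppTensorLift_tmul_single _ _ _).trans (P.lift_tPow u' v' m)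

@[simp]
theorem smallLiftSucc_smallY_s_mul :
    P.smallLiftSucc n u v u' v' (smallY k A n (P.s * P.tPow m)) = v' m :=
  (finsuppTensorLift_tmul_single _ _ _).trans (P.lift_s_mul u' v' m)

end

end SmallComplex

section Homology

variable {k A : Type*} [Field k] [Ring A] [Algebra k A] (P : PareigisBasis k A)

/-- The projection of the small complex to its homology in degree `0`. -/
noncomputable def homologyProjZero : A ⊗[k] (ResGen 0 →₀ k) →ₗ[k] k[T;T⁻¹] :=
  P.smallLiftZero (fun m => LaurentPolynomial.T m) 0

/-- The representatives of the homology of the small complex in degree `0`. -/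
noncomputable def homologyInclZero : k[T;T⁻¹] →ₗ[k] A ⊗[k] (ResGen 0 →₀ k) :=
  laurentLift fun m => smallX k A 0 (P.tPow m)

/-- The projection of the small complex to its homology in degree `1`. -/
noncomputable def homologyProjOne :
    A ⊗[k] (ResGen 1 →₀ k) →ₗ[k] k[T;T⁻¹] × laurentOdd k :=
  P.smallLiftSucc 0 0 (fun m => (0, oddT k m)) (fun m => (LaurentPolynomial.T (m + 1), 0)) 0

/-- The representatives of the homology of the small complex in degree `1`. -/
noncomputable def homologyInclOne :
    k[T;T⁻¹] × laurentOdd k →ₗ[k] A ⊗[k] (ResGen 1 →₀ k) :=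
  (laurentLift fun m => smallY k A 0 (P.tPow (m - 1))).coprod
    (laurentOddLift fun m => smallX k A 1 (P.s * P.tPow m))

/-- The projection of the small complex to its homology in degree at least `2`. -/
noncomputable def homologyProj (n : ℕ) :
    A ⊗[k] (ResGen (n + 2) →₀ k) →ₗ[k] laurentOdd k × laurentOdd k :=
  P.smallLiftSucc (n + 1) (fun m => if Even n then (oddT k m, 0) else 0)
    (fun m => if Even n then 0 else (oddT k m, 0))
    (fun m => if Even n then 0 else (0, oddT k (m + 1)))
    (fun m => if Even n then (0, oddT k (m + 1)) else 0)

/-- The representatives of the homology of the small complex in degree at least `2`. -/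
noncomputable def homologyIncl (n : ℕ) :
    laurentOdd k × laurentOdd k →ₗ[k] A ⊗[k] (ResGen (n + 2) →₀ k) :=
  (laurentOddLift fun m =>
      smallX k A (n + 2) (if Even n then P.tPow m else P.s * P.tPow m)).coprod
    (laurentOddLift fun m =>
      smallY k A (n + 1) (if Even n then P.s * P.tPow (m - 1) else P.tPow (m - 1)))

/-- The homotopy from the identity of the small complex to the projection onto its homology in
degree `0`. -/
noncomputable def smallHomotopyZero :
    A ⊗[k] (ResGen 0 →₀ k) →ₗ[k] A ⊗[k] (ResGen 1 →₀ k) :=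
  P.smallLiftZero 0 fun m => (2⁻¹ : k) • smallY k A 0 (P.s * P.tPow (m - 1))

/-- The homotopy from the identity of the small complex to the projection onto its homology. -/
noncomputable def smallHomotopy (n : ℕ) :
    A ⊗[k] (ResGen (n + 1) →₀ k) →ₗ[k] A ⊗[k] (ResGen (n + 2) →₀ k) :=
  P.smallLiftSucc n
    (fun m => if Even n then (2⁻¹ : k) • smallY k A (n + 1) (P.tPow (m - 1)) else 0)
    (fun m => if Even n then (if Even m then (2⁻¹ : k) • smallX k A (n + 2) (P.tPow m) else 0)
      else (2⁻¹ : k) • smallY k A (n + 1) (P.s * P.tPow (m - 1)))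
    0
    (fun m => if Even n ∨ Even m then 0 else -(2⁻¹ : k) • smallY k A (n + 1) (P.tPow m))

theorem homologyProjZero_incl (x : k[T;T⁻¹]) :
    P.homologyProjZero (P.homologyInclZero x) = x := by
  refine LinearMap.congr_fun (f := P.homologyProjZero ∘ₗ P.homologyInclZero) (g := LinearMap.id)
    (laurent_hom_ext fun m => ?_) x
  simp [homologyProjZero, homologyInclZero]

theorem homologyProjZero_smallD (z : A ⊗[k] (ResGen 1 →₀ k)) :
    P.homologyProjZero (P.smallD 0 z) = 0 := by
  refine LinearMap.congr_fun (f := P.homologyProjZero ∘ₗ P.smallD 0) (g := 0)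
    (P.small_succ_hom_ext (fun m => ?_) (fun m => ?_) (fun m => ?_) fun m => ?_) z <;>
  simp [homologyProjZero, smallD_smallX_tPow, smallD_smallX_s_mul, smallD_smallY_zero_tPow,
    smallD_smallY_zero_s_mul]

theorem homologyProjOne_incl (x : k[T;T⁻¹] × laurentOdd k) :
    P.homologyProjOne (P.homologyInclOne x) = x := by
  refine LinearMap.congr_fun (f := P.homologyProjOne ∘ₗ P.homologyInclOne) (g := LinearMap.id)
    (LinearMap.prod_ext (laurent_hom_ext fun m => ?_) (laurentOdd_hom_ext fun m hm => ?_)) x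
  · simp [homologyProjOne, homologyInclOne]
  · simp [homologyProjOne, homologyInclOne, laurentOddLift_of_odd _ hm]

theorem homologyProjOne_smallD (z : A ⊗[k] (ResGen 2 →₀ k)) :
    P.homologyProjOne (P.smallD 1 z) = 0 := by
  refine LinearMap.congr_fun (f := P.homologyProjOne ∘ₗ P.smallD 1) (g := 0)
    (P.small_succ_hom_ext (fun m => ?_) (fun m => ?_) (fun m => ?_) fun m => ?_) z <;>
  rcases Int.even_or_odd m with hm | hm <;>
  simp [homologyProjOne, smallD_smallX_tPow, smallD_smallX_s_mul, smallD_smallY_succ_tPow,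
    smallD_smallY_succ_s_mul, oddT_of_even, hm, intSign_odd, intSign_even]

theorem smallD_homologyInclOne (x : k[T;T⁻¹] × laurentOdd k) :
    P.smallD 0 (P.homologyInclOne x) = 0 := by
  refine LinearMap.congr_fun (f := P.smallD 0 ∘ₗ P.homologyInclOne) (g := 0)
    (LinearMap.prod_ext (laurent_hom_ext fun m => ?_) (laurentOdd_hom_ext fun m hm => ?_)) x
  · simp [homologyInclOne, smallD_smallY_zero_tPow]
  · simp [homologyInclOne, laurentOddLift_of_odd _ hm, smallD_smallX_s_mul]

theorem homologyProj_incl (n : ℕ) (x : laurentOdd k × laurentOdd k) :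
    P.homologyProj n (P.homologyIncl n x) = x := by
  refine LinearMap.congr_fun (f := P.homologyProj n ∘ₗ P.homologyIncl n) (g := LinearMap.id)
    (LinearMap.prod_ext (laurentOdd_hom_ext fun m hm => ?_)
      (laurentOdd_hom_ext fun m hm => ?_)) x <;>
  by_cases hn : Even n <;>
  simp [homologyProj, homologyIncl, laurentOddLift_of_odd _ hm, hn]

theorem homologyProj_smallD (n : ℕ) (z : A ⊗[k] (ResGen (n + 3) →₀ k)) :
    P.homologyProj n (P.smallD (n + 2) z) = 0 := by
  refine LinearMap.congr_fun (f := P.homologyProj n ∘ₗ P.smallD (n + 2)) (g := 0)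
    (P.small_succ_hom_ext (fun m => ?_) (fun m => ?_) (fun m => ?_) fun m => ?_) z <;>
  rcases Int.even_or_odd m with hm | hm <;>
  by_cases hn : Even n <;>
  simp [homologyProj, smallD_smallX_tPow, smallD_smallX_s_mul, smallD_smallY_succ_tPow,
    smallD_smallY_succ_s_mul, oddT_of_even, hm, hn, intSign_odd, intSign_even]

theorem smallD_homologyIncl (n : ℕ) (x : laurentOdd k × laurentOdd k) :
    P.smallD (n + 1) (P.homologyIncl n x) = 0 := by
  refine LinearMap.congr_fun (f := P.smallD (n + 1) ∘ₗ P.homologyIncl n) (g := 0)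
    (LinearMap.prod_ext (laurentOdd_hom_ext fun m hm => ?_)
      (laurentOdd_hom_ext fun m hm => ?_)) x <;>
  by_cases hn : Even n <;>
  simp [homologyIncl, laurentOddLift_of_odd _ hm, smallD_smallX_s_mul, smallD_smallX_tPow,
    smallD_smallY_succ_tPow, smallD_smallY_succ_s_mul, hn, hm, intSign_odd, intSign_even,
    intSign_add]

variable [CharZero k]

theorem smallHomotopyZero_spec (z : A ⊗[k] (ResGen 0 →₀ k)) :
    P.smallD 0 (P.smallHomotopyZero z) = z - P.homologyInclZero (P.homologyProjZero z) := by
  refine LinearMap.congr_fun (f := P.smallD 0 ∘ₗ P.smallHomotopyZero)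
    (g := LinearMap.id - P.homologyInclZero ∘ₗ P.homologyProjZero)
    (P.small_zero_hom_ext (fun m => ?_) fun m => ?_) z <;>
  simp [homologyProjZero, homologyInclZero, smallHomotopyZero, smallD_smallY_zero_s_mul]

theorem smallHomotopy_zero_spec (z : A ⊗[k] (ResGen 1 →₀ k)) :
    P.smallD 1 (P.smallHomotopy 0 z) + P.smallHomotopyZero (P.smallD 0 z) =
      z - P.homologyInclOne (P.homologyProjOne z) := by
  refine LinearMap.congr_fun
    (f := P.smallD 1 ∘ₗ P.smallHomotopy 0 + P.smallHomotopyZero ∘ₗ P.smallD 0)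
    (g := LinearMap.id - P.homologyInclOne ∘ₗ P.homologyProjOne)
    (P.small_succ_hom_ext (fun m => ?_) (fun m => ?_) (fun m => ?_) fun m => ?_) z <;>
  obtain ⟨hm, hm'⟩ | ⟨hm, hm'⟩ := m.even_and_not_odd_or
  all_goals
    simp [homologyProjOne, homologyInclOne, smallHomotopy, smallHomotopyZero,
      smallD_smallX_tPow, smallD_smallX_s_mul, smallD_smallY_succ_tPow, smallD_smallY_zero_tPow,
      smallD_smallY_zero_s_mul, oddT_of_even, hm, hm', intSign_odd,
      intSign_even, laurentOddLift_of_odd]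
  all_goals (match_scalars <;> ring)

theorem smallHomotopy_succ_spec (n : ℕ) (z : A ⊗[k] (ResGen (n + 2) →₀ k)) :
    P.smallD (n + 2) (P.smallHomotopy (n + 1) z) + P.smallHomotopy n (P.smallD (n + 1) z) =
      z - P.homologyIncl n (P.homologyProj n z) := by
  refine LinearMap.congr_fun
    (f := P.smallD (n + 2) ∘ₗ P.smallHomotopy (n + 1) + P.smallHomotopy n ∘ₗ P.smallD (n + 1))
    (g := LinearMap.id - P.homologyIncl n ∘ₗ P.homologyProj n)
    (P.small_succ_hom_ext (fun m => ?_) (fun m => ?_) (fun m => ?_) fun m => ?_) z <;>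
  obtain ⟨hm, hm'⟩ | ⟨hm, hm'⟩ := m.even_and_not_odd_or <;>
  by_cases hn : Even n
  all_goals
    simp [homologyProj, homologyIncl, smallHomotopy,
      smallD_smallX_tPow, smallD_smallX_s_mul, smallD_smallY_succ_tPow,
      smallD_smallY_succ_s_mul, oddT_of_even, hm, hm', hn, intSign_odd, Nat.even_add_one,
      intSign_even, intSign_add, laurentOddLift_of_odd]
  all_goals (match_scalars <;> ring)

end Homology

end PareigisBasis

section Degrees

variable {k M N Q : Type*} [CommRing k] [AddCommGroup M] [Module k M] [AddCommGroup N] [Module k N]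
  [AddCommGroup Q] [Module k Q]

/-- A map preserving degrees. -/
def MapsDegree (F : ℤ → Submodule k M) (G : ℤ → Submodule k N) (φ : M → N) : Prop :=
  ∀ r, ∀ x ∈ F r, φ x ∈ G r

/-- The elements of degree `r` in the image of a bilinear map. -/
def gradedImage (β : M →ₗ[k] N →ₗ[k] Q) (F : ℤ → Submodule k M) (G : ℤ → Submodule k N) (r : ℤ) :
    Submodule k Q :=
  Submodule.span k {x | ∃ i j a b, a ∈ F i ∧ b ∈ G j ∧ i + j = r ∧ x = β a b}

variable {β : M →ₗ[k] N →ₗ[k] Q} {F : ℤ → Submodule k M} {G : ℤ → Submodule k N}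

theorem mem_gradedImage {i j r : ℤ} {a : M} {b : N} (ha : a ∈ F i) (hb : b ∈ G j)
    (h : i + j = r) : β a b ∈ gradedImage β F G r :=
  Submodule.subset_span ⟨i, j, a, b, ha, hb, h, rfl⟩

theorem gradedImage_le {r : ℤ} {K : Submodule k Q}
    (h : ∀ i j a b, a ∈ F i → b ∈ G j → i + j = r → β a b ∈ K) : gradedImage β F G r ≤ K := by
  refine Submodule.span_le.mpr ?_
  rintro _ ⟨i, j, a, b, ha, hb, hr, rfl⟩
  exact h i j a b ha hb hr

theorem bilinear_mem_of_span {S : Set M} {T : Set N} {K : Submodule k Q}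
    (h : ∀ a ∈ S, ∀ b ∈ T, β a b ∈ K) {a : M} {b : N} (ha : a ∈ Submodule.span k S)
    (hb : b ∈ Submodule.span k T) : β a b ∈ K := by
  refine (Submodule.span_le (p := K.comap (β.flip b)) |>.mpr fun a ha => ?_) ha
  exact (Submodule.span_le (p := K.comap (β a)) |>.mpr fun b hb => h a ha b hb) hb

end Degrees

namespace PareigisElements

open EnvelopingAlgebra

variable {k A : Type*} [CommRing k] [Ring A] [Algebra k A] (P : PareigisElements k A)
  {V W : Type*} [AddCommGroup V] [Module k V] [AddCommGroup W] [Module k W]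

/-- The elements of degree `r` in `t`. -/
def algDeg (r : ℤ) : Submodule k A :=
  Submodule.span k {x | ∃ e : ℕ, x = P.s ^ e * P.tPow r}

/-- The elements of the enveloping algebra of degree `r` in `t`. -/
noncomputable def envDeg (r : ℤ) : Submodule k (EnvelopingAlgebra k A) :=
  gradedImage (biTmul k A) P.algDeg P.algDeg r

/-- The elements of a free bimodule of degree `r`. -/
noncomputable def freeDeg (G : ℤ → Submodule k V) (r : ℤ) :
    Submodule k (EnvelopingAlgebra k A ⊗[k] V) :=
  gradedImage (TensorProduct.mk k _ V) P.envDeg G r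

/-- The elements of the coinvariants of a free bimodule of degree `r`. -/
noncomputable def coinvDeg (G : ℤ → Submodule k V) (r : ℤ) : Submodule k (A ⊗[k] V) :=
  gradedImage (TensorProduct.mk k _ V) P.algDeg G r

/-- The words of total degree `r` in `t`. -/
noncomputable def wordDeg (n : ℕ) (r : ℤ) : Submodule k (TensorWords k A n) :=
  Submodule.span k {x | ∃ (e : Fin n → ℕ) (m : Fin n → ℤ), ∑ i, m i = r ∧
    x = PiTensorProduct.tprod k (fun i => P.s ^ e i * P.tPow (m i))}

/-- The degree in `t` of a generator of the small resolution. -/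
def resGenDegree : ∀ {n : ℕ}, ResGen n → ℤ
  | _, .x _ => 0
  | _, .y _ => 1

variable (k) in
/-- The span of the generators of degree `r` of the small resolution. -/
noncomputable def genDeg (n : ℕ) (r : ℤ) : Submodule k (ResGen n →₀ k) :=
  Submodule.span k {v | ∃ g : ResGen n, resGenDegree g = r ∧ v = Finsupp.single g 1}

theorem tPow_mem (r : ℤ) : P.tPow r ∈ P.algDeg r :=
  Submodule.subset_span ⟨0, by rw [pow_zero, one_mul]⟩

theorem s_mul_tPow_mem (r : ℤ) : P.s * P.tPow r ∈ P.algDeg r :=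
  Submodule.subset_span ⟨1, by rw [pow_one]⟩

theorem one_mem_algDeg : (1 : A) ∈ P.algDeg 0 := by
  rw [← P.tPow_zero]
  exact P.tPow_mem 0

theorem s_mem_algDeg : P.s ∈ P.algDeg 0 := by
  have := P.s_mul_tPow_mem 0
  rwa [tPow_zero, mul_one] at this

theorem algDeg_le {r : ℤ} {K : Submodule k A} (h1 : P.tPow r ∈ K) (h2 : P.s * P.tPow r ∈ K) :
    P.algDeg r ≤ K := by
  refine Submodule.span_le.mpr ?_
  rintro _ ⟨e, rfl⟩
  match e with
  | 0 => rwa [pow_zero, one_mul]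
  | 1 => rwa [pow_one]
  | e + 2 =>
    rw [pow_add, pow_two, s_mul_s, mul_zero, zero_mul]
    exact K.zero_mem

theorem mul_mem_algDeg {i j : ℤ} {a b : A} (ha : a ∈ P.algDeg i) (hb : b ∈ P.algDeg j) :
    a * b ∈ P.algDeg (i + j) := by
  refine P.algDeg_le (K := (P.algDeg (i + j)).comap (LinearMap.mulRight k b)) ?_ ?_ ha <;>
  refine P.algDeg_le (K := (P.algDeg (i + j)).comap (LinearMap.mulLeft k _)) ?_ ?_ hb
  · change P.tPow i * P.tPow j ∈ P.algDeg (i + j)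
    rw [← tPow_add]
    exact P.tPow_mem _
  · change P.tPow i * (P.s * P.tPow j) ∈ P.algDeg (i + j)
    rw [← mul_assoc, tPow_mul_s, smul_mul_assoc, mul_assoc, ← tPow_add]
    exact Submodule.smul_mem _ _ (P.s_mul_tPow_mem _)
  · change P.s * P.tPow i * P.tPow j ∈ P.algDeg (i + j)
    rw [mul_assoc, ← tPow_add]
    exact P.s_mul_tPow_mem _
  · change P.s * P.tPow i * (P.s * P.tPow j) ∈ P.algDeg (i + j)
    rw [← mul_assoc, s_mul_tPow_mul_s, zero_mul]
    exact Submodule.zero_mem _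

theorem biTmul_mem {i j r : ℤ} {p q : A} (hp : p ∈ P.algDeg i) (hq : q ∈ P.algDeg j)
    (h : i + j = r) : biTmul k A p q ∈ P.envDeg r :=
  mem_gradedImage hp hq h

theorem one_mem_envDeg : (1 : EnvelopingAlgebra k A) ∈ P.envDeg 0 :=
  P.biTmul_mem P.one_mem_algDeg P.one_mem_algDeg (zero_add 0)

theorem mul_mem_envDeg {i j r : ℤ} {x y : EnvelopingAlgebra k A} (hx : x ∈ P.envDeg i)
    (hy : y ∈ P.envDeg j) (h : i + j = r) : x * y ∈ P.envDeg r := by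
  refine bilinear_mem_of_span (β := LinearMap.mul k (EnvelopingAlgebra k A)) ?_ hx hy
  rintro _ ⟨i1, i2, p, q, hp, hq, hi, rfl⟩ _ ⟨j1, j2, p', q', hp', hq', hj, rfl⟩
  rw [LinearMap.mul_apply', biTmul_mul_biTmul]
  exact P.biTmul_mem (P.mul_mem_algDeg hp hp') (P.mul_mem_algDeg hq' hq) (by omega)

theorem envelopeMul_mem {r : ℤ} {e : EnvelopingAlgebra k A} (he : e ∈ P.envDeg r) :
    envelopeMul k A e ∈ P.algDeg r := by
  refine gradedImage_le (K := (P.algDeg r).comap (envelopeMul k A)) ?_ he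
  rintro i j p q hp hq rfl
  rw [Submodule.mem_comap, envelopeMul_mk, add_comm]
  exact P.mul_mem_algDeg hq hp

section Free

variable {G : ℤ → Submodule k V} {H : ℤ → Submodule k W}

theorem tmul_mem_freeDeg {i j r : ℤ} {e : EnvelopingAlgebra k A} {v : V} (he : e ∈ P.envDeg i)
    (hv : v ∈ G j) (h : i + j = r) : e ⊗ₜ v ∈ P.freeDeg G r :=
  Submodule.subset_span ⟨i, j, e, v, he, hv, h, rfl⟩

theorem tmul_mem_coinvDeg {i j r : ℤ} {a : A} {v : V} (ha : a ∈ P.algDeg i)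
    (hv : v ∈ G j) (h : i + j = r) : a ⊗ₜ v ∈ P.coinvDeg G r :=
  Submodule.subset_span ⟨i, j, a, v, ha, hv, h, rfl⟩

theorem freeDeg_le {r : ℤ} {K : Submodule k (EnvelopingAlgebra k A ⊗[k] V)}
    (h : ∀ i j l p q v, p ∈ P.algDeg i → q ∈ P.algDeg j → v ∈ G l → i + j + l = r →
      biTmul k A p q ⊗ₜ v ∈ K) : P.freeDeg G r ≤ K := by
  refine gradedImage_le fun i l e v he hv hr => ?_
  refine gradedImage_le (K := K.comap ((TensorProduct.mk k _ V).flip v))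
    (fun i' j' p q hp hq hi => ?_) he
  exact h i' j' l p q v hp hq hv (by omega)

theorem smul_mem_freeDeg {i j r : ℤ} {e : EnvelopingAlgebra k A}
    {z : EnvelopingAlgebra k A ⊗[k] V} (he : e ∈ P.envDeg i) (hz : z ∈ P.freeDeg G j)
    (h : i + j = r) : e • z ∈ P.freeDeg G r := by
  refine gradedImage_le (K := (P.freeDeg G r).comap (Algebra.lsmul k k _ e)) ?_ hz
  rintro j1 j2 e' v he' hv rfl
  exact P.tmul_mem_freeDeg (P.mul_mem_envDeg he he' rfl) hv (by omega)

theorem mapsDegree_freeLift {γ : V →ₗ[k] EnvelopingAlgebra k A ⊗[k] W}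
    (h : MapsDegree G (P.freeDeg H) γ) :
    MapsDegree (P.freeDeg G) (P.freeDeg H) (freeLift (E := EnvelopingAlgebra k A) γ) := by
  intro r z hz
  refine gradedImage_le
    (K := (P.freeDeg H r).comap ((freeLift (E := EnvelopingAlgebra k A) γ).restrictScalars k)) ?_ hz
  intro i j e v he hv hr
  exact P.smul_mem_freeDeg he (h j v hv) hr

theorem mapsDegree_coinvMap
    {Φ : EnvelopingAlgebra k A ⊗[k] V →ₗ[EnvelopingAlgebra k A] EnvelopingAlgebra k A ⊗[k] W}
    (h : MapsDegree (P.freeDeg G) (P.freeDeg H) Φ) :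
    MapsDegree (P.coinvDeg G) (P.coinvDeg H) (coinvMap Φ) := by
  intro r z hz
  refine gradedImage_le (K := (P.coinvDeg H r).comap (coinvMap Φ)) ?_ hz
  intro i j a v ha hv hr
  have h1 := h r _ (P.tmul_mem_freeDeg (P.biTmul_mem P.one_mem_algDeg ha (zero_add i)) hv hr)
  refine gradedImage_le (K := (P.coinvDeg H r).comap (coinvMk k A W)) ?_ h1
  intro i' j' e w he hw hr'
  exact P.tmul_mem_coinvDeg (P.envelopeMul_mem he) hw hr'

end Free

theorem mapsDegree_comparison {V W : ℕ → Type*} [∀ n, AddCommGroup (V n)] [∀ n, Module k (V n)]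
    [∀ n, AddCommGroup (W n)] [∀ n, Module k (W n)] {G : ∀ n, ℤ → Submodule k (V n)}
    {H : ∀ n, ℤ → Submodule k (W n)}
    {φ : EnvelopingAlgebra k A ⊗[k] V 0 →ₗ[EnvelopingAlgebra k A] EnvelopingAlgebra k A ⊗[k] W 0}
    {d : ∀ n, EnvelopingAlgebra k A ⊗[k] V (n + 1) →ₗ[EnvelopingAlgebra k A]
      EnvelopingAlgebra k A ⊗[k] V n}
    {σ : ∀ n, EnvelopingAlgebra k A ⊗[k] W n →ₗ[k] EnvelopingAlgebra k A ⊗[k] W (n + 1)}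
    (hφ : MapsDegree (P.freeDeg (G 0)) (P.freeDeg (H 0)) φ)
    (hd : ∀ n, MapsDegree (P.freeDeg (G (n + 1))) (P.freeDeg (G n)) (d n))
    (hσ : ∀ n, MapsDegree (P.freeDeg (H n)) (P.freeDeg (H (n + 1))) (σ n)) (n : ℕ) :
    MapsDegree (P.freeDeg (G n)) (P.freeDeg (H n)) (comparison φ d σ n) := by
  induction n with
  | zero => exact hφ
  | succ n ih =>
    refine P.mapsDegree_freeLift fun r v hv => ?_
    exact hσ n r _ (ih r _ (hd n r _ (P.tmul_mem_freeDeg P.one_mem_envDeg hv (zero_add r))))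

section Bar

theorem mapsDegree_consEquiv (n : ℕ) :
    MapsDegree (P.coinvDeg (P.wordDeg n)) (P.wordDeg (n + 1)) (consEquiv k A n) := by
  intro r z hz
  refine gradedImage_le (K := (P.wordDeg (n + 1) r).comap (consEquiv k A n).toLinearMap) ?_ hz
  intro i j a w ha hw hr
  refine bilinear_mem_of_span (β := TensorProduct.mk k _ _) ?_ ha hw
  rintro _ ⟨e, rfl⟩ _ ⟨e', m, hm, rfl⟩
  rw [Submodule.mem_comap, TensorProduct.mk_apply, LinearEquiv.coe_coe, consEquiv_tmul_tprod]
  refine Submodule.subset_span ⟨Fin.cons e e', Fin.cons i m, ?_, ?_⟩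
  · rw [Fin.sum_cons, hm, hr]
  · congr 1
    funext l
    cases l using Fin.cases <;> simp

theorem mapsDegree_consEquiv_symm (n : ℕ) :
    MapsDegree (P.wordDeg (n + 1)) (P.coinvDeg (P.wordDeg n)) (consEquiv k A n).symm := by
  intro r z hz
  refine (Submodule.span_le
    (p := (P.coinvDeg (P.wordDeg n) r).comap (consEquiv k A n).symm.toLinearMap)).mpr ?_ hz
  rintro _ ⟨e, m, hm, rfl⟩
  rw [SetLike.mem_coe, Submodule.mem_comap, LinearEquiv.coe_coe, consEquiv_symm_tprod]
  rw [Fin.sum_univ_succ] at hm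
  exact P.tmul_mem_coinvDeg (Submodule.subset_span ⟨e 0, rfl⟩)
    (Submodule.subset_span ⟨Fin.tail e, Fin.tail m, rfl, rfl⟩) hm

theorem mapsDegree_barContraction (n : ℕ) : MapsDegree (P.freeDeg (P.wordDeg n))
    (P.freeDeg (P.wordDeg (n + 1))) (barContraction k A n) := by
  intro r z hz
  refine P.freeDeg_le (K := (P.freeDeg (P.wordDeg (n + 1)) r).comap (barContraction k A n)) ?_ hz
  intro i j l p q v hp hq hv hr
  rw [Submodule.mem_comap, barContraction_tmul]
  exact P.tmul_mem_freeDeg (P.biTmul_mem P.one_mem_algDeg hq rfl)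
    (P.mapsDegree_consEquiv n _ _ (P.tmul_mem_coinvDeg hp hv rfl)) (by omega)

theorem mapsDegree_leftCoeff (G : ℤ → Submodule k V) :
    MapsDegree (P.coinvDeg G) (P.freeDeg G) (leftCoeff k A V) := by
  intro r z hz
  refine gradedImage_le (K := (P.freeDeg G r).comap (leftCoeff k A V)) ?_ hz
  intro i j a v ha hv hr
  exact P.tmul_mem_freeDeg (P.biTmul_mem ha P.one_mem_algDeg (add_zero i)) hv hr

theorem mapsDegree_coinvSection (G : ℤ → Submodule k V) :
    MapsDegree (P.coinvDeg G) (P.freeDeg G) (coinvSection k A V) := by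
  intro r z hz
  refine gradedImage_le (K := (P.freeDeg G r).comap (coinvSection k A V)) ?_ hz
  intro i j a v ha hv hr
  exact P.tmul_mem_freeDeg (P.biTmul_mem P.one_mem_algDeg ha (zero_add i)) hv hr

theorem mapsDegree_barD (n : ℕ) : MapsDegree (P.freeDeg (P.wordDeg (n + 1)))
    (P.freeDeg (P.wordDeg n)) (barD k A n) := by
  induction n with
  | zero =>
    refine P.mapsDegree_freeLift fun r v hv => ?_
    have h := P.mapsDegree_consEquiv_symm 0 r v hv
    exact Submodule.sub_mem _ (P.mapsDegree_leftCoeff _ r _ h) (P.mapsDegree_coinvSection _ r _ h)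
  | succ n ih =>
    refine P.mapsDegree_freeLift fun r v hv => ?_
    have h := P.mapsDegree_leftCoeff _ r _ (P.mapsDegree_consEquiv_symm (n + 1) r v hv)
    exact Submodule.sub_mem _ h (P.mapsDegree_barContraction n r _ (ih r _ h))

end Bar

section Res

theorem single_mem_genDeg {n : ℕ} (g : ResGen n) :
    Finsupp.single g 1 ∈ genDeg k n (resGenDegree g) :=
  Submodule.subset_span ⟨g, rfl, rfl⟩

theorem resX_mem {n : ℕ} {r : ℤ} {e : EnvelopingAlgebra k A} (he : e ∈ P.envDeg r) :
    resX k A n e ∈ P.freeDeg (genDeg k n) r := by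
  rw [← tmul_x]
  exact P.tmul_mem_freeDeg he (single_mem_genDeg (ResGen.x n)) (add_zero r)

theorem resY_mem {n : ℕ} {i r : ℤ} {e : EnvelopingAlgebra k A} (he : e ∈ P.envDeg i)
    (h : i + 1 = r) : resY k A n e ∈ P.freeDeg (genDeg k (n + 1)) r := by
  rw [← tmul_y]
  exact P.tmul_mem_freeDeg he (single_mem_genDeg (ResGen.y n)) h

theorem sDiff_mem (n : ℤ) : P.sDiff n ∈ P.envDeg 0 :=
  Submodule.sub_mem _ (P.biTmul_mem P.s_mem_algDeg P.one_mem_algDeg rfl)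
    (Submodule.smul_mem _ _ (P.biTmul_mem P.one_mem_algDeg P.s_mem_algDeg rfl))

theorem tDiff_mem (n : ℤ) : P.tDiff n ∈ P.envDeg 1 :=
  Submodule.sub_mem _ (P.biTmul_mem (P.tPow_mem 1) P.one_mem_algDeg rfl)
    (Submodule.smul_mem _ _ (P.biTmul_mem P.one_mem_algDeg (P.tPow_mem 1) rfl))

theorem diffQuot_mem (n m : ℤ) : P.diffQuot n m ∈ P.envDeg (m - 1) := by
  refine Submodule.sub_mem _ ?_ ?_ <;>
  exact Submodule.sum_mem _ fun i _ => Submodule.smul_mem _ _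
    (P.biTmul_mem (P.tPow_mem _) (P.tPow_mem _) (by omega))

theorem mapsDegree_linearCombination {n : ℕ} {N : Type*} [AddCommGroup N] [Module k N]
    {H : ℤ → Submodule k N} {γ : ResGen n → N} (h : ∀ g, γ g ∈ H (resGenDegree g)) :
    MapsDegree (genDeg k n) H (Finsupp.linearCombination k γ) := by
  intro r v hv
  refine (Submodule.span_le (p := (H r).comap (Finsupp.linearCombination k γ))).mpr ?_ hv
  rintro _ ⟨g, rfl, rfl⟩
  rw [SetLike.mem_coe, Submodule.mem_comap, Finsupp.linearCombination_single, one_smul]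
  exact h g

theorem mapsDegree_resD (n : ℕ) : MapsDegree (P.freeDeg (genDeg k (n + 1)))
    (P.freeDeg (genDeg k n)) (P.resD n) := by
  refine P.mapsDegree_freeLift (mapsDegree_linearCombination fun g => ?_)
  match n, g with
  | 0, .x _ => exact P.resX_mem (P.sDiff_mem 0)
  | 0, .y _ => exact P.resX_mem (P.tDiff_mem 0)
  | n + 1, .x _ => exact P.resX_mem (P.sDiff_mem _)
  | n + 1, .y _ =>
    exact Submodule.add_mem _ (P.resX_mem (P.tDiff_mem _)) (P.resY_mem (P.sDiff_mem _) rfl)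

theorem mapsDegree_resToBarZero : MapsDegree (P.freeDeg (genDeg k 0)) (P.freeDeg (P.wordDeg 0))
    (PareigisBasis.resToBarZero k A) := by
  refine P.mapsDegree_freeLift (mapsDegree_linearCombination fun g => ?_)
  cases g
  exact P.tmul_mem_freeDeg P.one_mem_envDeg
    (Submodule.subset_span ⟨Fin.elim0, Fin.elim0, rfl, congrArg _ (Subsingleton.elim _ _)⟩) rfl

theorem mapsDegree_barToResZero : MapsDegree (P.freeDeg (P.wordDeg 0)) (P.freeDeg (genDeg k 0))
    (PareigisBasis.barToResZero k A) := by
  refine P.mapsDegree_freeLift fun r v hv => ?_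
  refine (Submodule.span_le (p := (P.freeDeg (genDeg k 0) r).comap _)).mpr ?_ hv
  rintro _ ⟨e, m, rfl, rfl⟩
  rw [SetLike.mem_coe, Submodule.mem_comap, LinearMap.comp_apply, LinearEquiv.coe_coe,
    PiTensorProduct.isEmptyEquiv_apply_tprod, LinearMap.toSpanSingleton_apply, one_smul]
  exact P.resX_mem P.one_mem_envDeg

end Res

end PareigisElements

namespace PareigisBasis

open EnvelopingAlgebra PareigisElements

section Comparison

variable {k A : Type*} [CommRing k] [Ring A] [Algebra k A] (P : PareigisBasis k A)

theorem mapsDegree_resContractionX (n : ℕ) :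
    MapsDegree P.algDeg (P.freeDeg (genDeg k (n + 1))) (P.resContractionX n) := by
  intro r a ha
  refine P.algDeg_le (K := (P.freeDeg (genDeg k (n + 1)) r).comap (P.resContractionX n))
    ?_ ?_ ha
  · rw [Submodule.mem_comap, resContractionX, lift_tPow]
    exact P.resY_mem (P.diffQuot_mem _ _) (by omega)
  · rw [Submodule.mem_comap, resContractionX, lift_s_mul]
    refine Submodule.add_mem _ (P.resY_mem (P.mul_mem_envDeg
      (P.biTmul_mem P.s_mem_algDeg P.one_mem_algDeg rfl) (P.diffQuot_mem _ _) rfl) (by omega))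
      (Submodule.smul_mem _ _ (P.resX_mem (P.biTmul_mem P.one_mem_algDeg (P.tPow_mem _)
        (zero_add r))))

theorem mapsDegree_resContraction (n : ℕ) : MapsDegree (P.freeDeg (genDeg k n))
    (P.freeDeg (genDeg k (n + 1))) (P.resContraction n) := by
  intro r z hz
  refine gradedImage_le
    (K := (P.freeDeg (genDeg k (n + 1)) r).comap (P.resContraction n)) ?_ hz
  intro i j e v he hv hr
  refine bilinear_mem_of_span (β := TensorProduct.mk k _ _) ?_ he hv
  rintro _ ⟨i1, i2, p, q, hp, hq, hi, rfl⟩ _ ⟨g, rfl, rfl⟩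
  rw [Submodule.mem_comap, TensorProduct.mk_apply]
  match n, g with
  | _, .x n =>
    rw [tmul_x, resContraction_x, rightExtend_biTmul]
    rw [show resGenDegree (ResGen.x n) = 0 from rfl] at hr
    exact P.smul_mem_freeDeg (P.biTmul_mem P.one_mem_algDeg hq (zero_add _))
      (P.mapsDegree_resContractionX n _ _ hp) (by omega)
  | _, .y n =>
    rw [tmul_y, resContraction_y]
    exact Submodule.zero_mem _

theorem mapsDegree_resToBar (n : ℕ) : MapsDegree (P.freeDeg (genDeg k n))
    (P.freeDeg (P.wordDeg n)) (P.resToBar n) :=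
  P.mapsDegree_comparison (V := fun n => ResGen n →₀ k) (W := TensorWords k A)
    (G := genDeg k) (H := P.wordDeg)
    P.mapsDegree_resToBarZero P.mapsDegree_resD P.mapsDegree_barContraction n

theorem mapsDegree_barToRes (n : ℕ) : MapsDegree (P.freeDeg (P.wordDeg n))
    (P.freeDeg (genDeg k n)) (P.barToRes n) :=
  P.mapsDegree_comparison (V := TensorWords k A) (W := fun n => ResGen n →₀ k)
    (G := P.wordDeg) (H := genDeg k)
    P.mapsDegree_barToResZero P.mapsDegree_barD P.mapsDegree_resContraction n

theorem mapsDegree_smallToHochschild (n : ℕ) :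
    MapsDegree (P.coinvDeg (genDeg k n)) (P.wordDeg (n + 1)) (P.smallToHochschild n) :=
  fun r z hz => P.mapsDegree_consEquiv n r _
    (P.mapsDegree_coinvMap (P.mapsDegree_resToBar n) r z hz)

theorem mapsDegree_hochschildToSmall (n : ℕ) :
    MapsDegree (P.wordDeg (n + 1)) (P.coinvDeg (genDeg k n)) (P.hochschildToSmall n) :=
  fun r z hz => P.mapsDegree_coinvMap (P.mapsDegree_barToRes n) r _
    (P.mapsDegree_consEquiv_symm n r z hz)

theorem smallX_mem {n : ℕ} {r : ℤ} {a : A} (ha : a ∈ P.algDeg r) :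
    smallX k A n a ∈ P.coinvDeg (genDeg k n) r :=
  P.tmul_mem_coinvDeg ha (single_mem_genDeg (ResGen.x n)) (add_zero r)

theorem smallY_mem {n : ℕ} {i r : ℤ} {a : A} (ha : a ∈ P.algDeg i) (h : i + 1 = r) :
    smallY k A n a ∈ P.coinvDeg (genDeg k (n + 1)) r :=
  P.tmul_mem_coinvDeg ha (single_mem_genDeg (ResGen.y n)) h

theorem mapsDegree_small_zero {N : Type*} [AddCommGroup N] [Module k N] {H : ℤ → Submodule k N}
    {φ : A ⊗[k] (ResGen 0 →₀ k) →ₗ[k] N} (h1 : ∀ m, φ (smallX k A 0 (P.tPow m)) ∈ H m)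
    (h2 : ∀ m, φ (smallX k A 0 (P.s * P.tPow m)) ∈ H m) :
    MapsDegree (P.coinvDeg (genDeg k 0)) H φ := by
  intro r z hz
  refine gradedImage_le (K := (H r).comap φ) ?_ hz
  intro i j a v ha hv hr
  refine (Submodule.span_le (p := ((H r).comap φ).comap (TensorProduct.mk k A _ a))).mpr ?_ hv
  rintro _ ⟨g, rfl, rfl⟩
  cases g with
  | x =>
    obtain rfl : i = r := (add_zero i).symm.trans hr
    exact P.algDeg_le (K := (H i).comap (φ ∘ₗ smallX k A 0)) (h1 i) (h2 i) ha

theorem mapsDegree_small_succ {N : Type*} [AddCommGroup N] [Module k N] {H : ℤ → Submodule k N}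
    {n : ℕ} {φ : A ⊗[k] (ResGen (n + 1) →₀ k) →ₗ[k] N}
    (h1 : ∀ m, φ (smallX k A (n + 1) (P.tPow m)) ∈ H m)
    (h2 : ∀ m, φ (smallX k A (n + 1) (P.s * P.tPow m)) ∈ H m)
    (h3 : ∀ m, φ (smallY k A n (P.tPow m)) ∈ H (m + 1))
    (h4 : ∀ m, φ (smallY k A n (P.s * P.tPow m)) ∈ H (m + 1)) :
    MapsDegree (P.coinvDeg (genDeg k (n + 1))) H φ := by
  intro r z hz
  refine gradedImage_le (K := (H r).comap φ) ?_ hz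
  intro i j a v ha hv hr
  refine (Submodule.span_le (p := ((H r).comap φ).comap (TensorProduct.mk k A _ a))).mpr ?_ hv
  rintro _ ⟨g, rfl, rfl⟩
  cases g with
  | x =>
    obtain rfl : i = r := (add_zero i).symm.trans hr
    exact P.algDeg_le (K := (H i).comap (φ ∘ₗ smallX k A (n + 1))) (h1 i) (h2 i) ha
  | y =>
    obtain rfl : i + 1 = r := hr
    exact P.algDeg_le (K := (H (i + 1)).comap (φ ∘ₗ smallY k A n)) (h3 i) (h4 i) ha

end Comparison

end PareigisBasis

section LaurentDegrees

variable {k : Type*} [CommRing k] {N : Type*} [AddCommGroup N] [Module k N]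

theorem T_mem_laurentDegree (m : ℤ) : LaurentPolynomial.T m ∈ laurentDegree k m :=
  Submodule.mem_span_singleton_self _

theorem oddT_mem_laurentOddDegree (m : ℤ) : oddT k m ∈ laurentOddDegree k m := by
  rcases Int.even_or_odd m with h | h
  · rw [oddT_of_even h]
    exact Submodule.zero_mem _
  · rw [laurentOddDegree, Submodule.submoduleOf, Submodule.mem_comap, Submodule.subtype_apply,
      oddT_of_odd h]
    exact T_mem_laurentDegree m

theorem mapsDegree_laurentLift {H : ℤ → Submodule k N} {u : ℤ → N} (h : ∀ m, u m ∈ H m) :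
    MapsDegree (laurentDegree k) H (laurentLift u) := by
  intro r x hx
  obtain ⟨c, rfl⟩ := Submodule.mem_span_singleton.mp hx
  rw [map_smul, laurentLift_T]
  exact Submodule.smul_mem _ _ (h r)

theorem mapsDegree_laurentOddLift {H : ℤ → Submodule k N} {u : ℤ → N} (h : ∀ m, u m ∈ H m) :
    MapsDegree (laurentOddDegree k) H (laurentOddLift u) :=
  fun r _ hx => mapsDegree_laurentLift h r _ hx

theorem mapsDegree_coprod {M M' : Type*} [AddCommGroup M] [Module k M] [AddCommGroup M']
    [Module k M'] {F : ℤ → Submodule k M} {F' : ℤ → Submodule k M'} {H : ℤ → Submodule k N}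
    {φ : M →ₗ[k] N} {φ' : M' →ₗ[k] N} (h : MapsDegree F H φ) (h' : MapsDegree F' H φ') :
    MapsDegree (fun r => (F r).prod (F' r)) H (φ.coprod φ') :=
  fun r _ hx => Submodule.add_mem _ (h r _ hx.1) (h' r _ hx.2)

end LaurentDegrees

namespace PareigisBasis

open PareigisElements

section HomologyDegrees

variable {k A : Type*} [Field k] [Ring A] [Algebra k A] (P : PareigisBasis k A)

theorem mapsDegree_homologyProjZero :
    MapsDegree (P.coinvDeg (genDeg k 0)) (laurentDegree k) P.homologyProjZero := by
  refine P.mapsDegree_small_zero (fun m => ?_) fun m => ?_ <;>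
  simp [homologyProjZero, T_mem_laurentDegree]

theorem mapsDegree_homologyInclZero :
    MapsDegree (laurentDegree k) (P.coinvDeg (genDeg k 0)) P.homologyInclZero :=
  mapsDegree_laurentLift fun m => P.smallX_mem (P.tPow_mem m)

theorem mapsDegree_homologyProjOne : MapsDegree (P.coinvDeg (genDeg k 1))
    (fun r => (laurentDegree k r).prod (laurentOddDegree k r)) P.homologyProjOne := by
  refine P.mapsDegree_small_succ (fun m => ?_) (fun m => ?_) (fun m => ?_) fun m => ?_ <;>
  simp [homologyProjOne, T_mem_laurentDegree, oddT_mem_laurentOddDegree]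

theorem mapsDegree_homologyInclOne :
    MapsDegree (fun r => (laurentDegree k r).prod (laurentOddDegree k r))
      (P.coinvDeg (genDeg k 1)) P.homologyInclOne :=
  mapsDegree_coprod
    (mapsDegree_laurentLift fun m => P.smallY_mem (P.tPow_mem _) (sub_add_cancel m 1))
    (mapsDegree_laurentOddLift fun m => P.smallX_mem (P.s_mul_tPow_mem m))

theorem mapsDegree_homologyProj (n : ℕ) : MapsDegree (P.coinvDeg (genDeg k (n + 2)))
    (fun r => (laurentOddDegree k r).prod (laurentOddDegree k r)) (P.homologyProj n) := by
  refine P.mapsDegree_small_succ (fun m => ?_) (fun m => ?_) (fun m => ?_) fun m => ?_ <;>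
  by_cases hn : Even n <;>
  simp [homologyProj, oddT_mem_laurentOddDegree, hn]

theorem mapsDegree_homologyIncl (n : ℕ) :
    MapsDegree (fun r => (laurentOddDegree k r).prod (laurentOddDegree k r))
      (P.coinvDeg (genDeg k (n + 2))) (P.homologyIncl n) := by
  refine mapsDegree_coprod (mapsDegree_laurentOddLift fun m => P.smallX_mem ?_)
    (mapsDegree_laurentOddLift fun m => P.smallY_mem ?_ (sub_add_cancel m 1)) <;>
  by_cases hn : Even n <;>
  simp [hn, tPow_mem, s_mul_tPow_mem]

end HomologyDegrees

end PareigisBasis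

/-- The Hochschild homology of Pareigis' algebra with its grading is computed by the small
complex. -/
theorem exists_graded_hochschildHomology_equiv {k : Type*} [Field k] (n : ℕ) {N : Type*}
    [AddCommGroup N] [Module k N] {H : ℤ → Submodule k N}
    {Ψ : PareigisAlgebra k ⊗[k] (ResGen n →₀ k) →ₗ[k] N}
    {Φ : N →ₗ[k] PareigisAlgebra k ⊗[k] (ResGen n →₀ k)}
    (hΨΦ : ∀ x, Ψ (Φ x) = x) (hΦ : ∀ x, Φ x ∈ (PareigisAlgebra.monomialBasis k).smallCycles n)
    (hΨ : ∀ z, Ψ ((PareigisAlgebra.monomialBasis k).smallD n z) = 0)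
    (h : ∀ z ∈ (PareigisAlgebra.monomialBasis k).smallCycles n,
      z - Φ (Ψ z) ∈ LinearMap.range ((PareigisAlgebra.monomialBasis k).smallD n))
    (dΨ : MapsDegree ((PareigisAlgebra.monomialBasis k).coinvDeg (PareigisElements.genDeg k n))
      H Ψ)
    (dΦ : MapsDegree H
      ((PareigisAlgebra.monomialBasis k).coinvDeg (PareigisElements.genDeg k n)) Φ) :
    ∃ e : HochschildHomology k (PareigisAlgebra k) n ≃ₗ[k] N,
      ∀ r : ℤ, (pareigisHomologyOfDegree k n r).map e.toLinearMap = H r := by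
  obtain ⟨e, he, he'⟩ :=
    (PareigisAlgebra.monomialBasis k).exists_hochschildHomology_equiv n Ψ Φ hΨΦ hΦ hΨ h
  refine ⟨e, fun r => le_antisymm ?_ fun x hx => ?_⟩
  · rintro _ ⟨_, ⟨z, hz, rfl⟩, rfl⟩
    have := dΨ r _ ((PareigisAlgebra.monomialBasis k).mapsDegree_hochschildToSmall n r _ hz)
    exact (he z).symm ▸ this
  · obtain ⟨hx', h'⟩ := he' x
    exact ⟨_, ⟨_, (PareigisAlgebra.monomialBasis k).mapsDegree_smallToHochschild n r _
      (dΦ r x hx), rfl⟩, h'⟩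

theorem mainTheorem11 (k : Type*) [Field k] [CharZero k] :
    (∃ e : HochschildHomology k (PareigisAlgebra k) 0 ≃ₗ[k] k[T;T⁻¹],
      ∀ r : ℤ, (pareigisHomologyOfDegree k 0 r).map e.toLinearMap = laurentDegree k r) ∧
    (∃ e : HochschildHomology k (PareigisAlgebra k) 1 ≃ₗ[k] k[T;T⁻¹] × laurentOdd k,
      ∀ r : ℤ, (pareigisHomologyOfDegree k 1 r).map e.toLinearMap =
        (laurentDegree k r).prod (laurentOddDegree k r)) ∧
    (∀ n : ℕ, 1 < n →
      ∃ e : HochschildHomology k (PareigisAlgebra k) n ≃ₗ[k] laurentOdd k × laurentOdd k,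
        ∀ r : ℤ, (pareigisHomologyOfDegree k n r).map e.toLinearMap =
          (laurentOddDegree k r).prod (laurentOddDegree k r)) := by
  let P := PareigisAlgebra.monomialBasis k
  refine ⟨?_, ?_, fun n hn => ?_⟩
  · exact exists_graded_hochschildHomology_equiv 0 P.homologyProjZero_incl (fun _ => trivial)
      P.homologyProjZero_smallD
      (fun z _ => ⟨_, P.smallHomotopyZero_spec z⟩) P.mapsDegree_homologyProjZero
      P.mapsDegree_homologyInclZero
  · refine exists_graded_hochschildHomology_equiv 1 P.homologyProjOne_incl
      P.smallD_homologyInclOne P.homologyProjOne_smallD (fun z hz => ⟨P.smallHomotopy 0 z, ?_⟩)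
      P.mapsDegree_homologyProjOne P.mapsDegree_homologyInclOne
    have hz : P.smallD 0 z = 0 := hz
    rw [← P.smallHomotopy_zero_spec, hz, map_zero, add_zero]
  · obtain ⟨n, rfl⟩ := Nat.exists_eq_add_of_le' hn
    refine exists_graded_hochschildHomology_equiv (n + 2) (P.homologyProj_incl n)
      (P.smallD_homologyIncl n) (P.homologyProj_smallD n)
      (fun z hz => ⟨P.smallHomotopy (n + 1) z, ?_⟩)
      (P.mapsDegree_homologyProj n) (P.mapsDegree_homologyIncl n)
    have hz : P.smallD (n + 1) z = 0 := hz
    rw [← P.smallHomotopy_succ_spec, hz, map_zero, add_zero]
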